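/- An $\mathbb{R}$-tree is a metric space $T$ such that (1) for all $a,b\in T$ there is a unique isometry $\phi_{ab}:[0,d(a,b)]\to T$ with $\phi_{ab}(0)=a$ and $\phi_{ab}(d(a,b))=b$, and (2) every injective continuous map $\varphi:[0,1]\to T$ has the same range $[a,b]:=\phi_{ab}([0,d(a,b)])$ as the isometry $\phi_{ab}$ associated with $a=\varphi(0)$, $b=\varphi(1)$. Call $A\subseteq T$ measurable if $\phi_{xy}^{-1}(A)$ is Lebesgue measurable for all $x,y\in T$. The length measure $\lambda_T$ on the $\sigma$-algebra of measurable sets is $$\lambda_T(A)=\sup\sum_{k=1}^n\lambda\big(\phi_{x_ky_k}^{-1}(A)\big),$$ where $\lambda$ is the Lebesgue measure and the supremum is over all finite families of pairwise disjoint segments $[x_k,y_k]$ of $T$. For a metric space $M$ with origin $0$, let $\mathrm{Lip}_0(M)$ be the space of real-valued Lipschitz functions on $M$ vanishing at $0$, normed by the least Lipschitz constant; the Lipschitz-free space $\mathcal F(M)$ is the closed linear span in $\mathrm{Lip}_0(M)^*$ of the evaluation functionals $\delta_x:f\mapsto f(x)$, $x\in M$. **Corollary.** Let $T$ be an $\mathbb{R}$-tree,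 with any point of $T$ as origin. Then $\mathcal F(T)$ is linearly isometric to the real Banach space $L_1(T)=L_1(\lambda_T)$. In particular, if $T$ is separable and has more than one point, then $\mathcal F(T)$ is linearly isometric to $L_1=L_1([0,1])$ (with the Lebesgue measure). -/

import Mathlib

open MeasureTheory Set
open scoped ENNReal NNReal

/-! ### Lipschitz-free spaces -/

/-- The vector space of real-valued Lipschitz functions on `M` vanishing at the origin `o`. -/
def lipSubmodule {M : Type*} [MetricSpace M] (o : M) : Submodule ℝ (M → ℝ) where
  carrier := {f | f o = 0 ∧ ∃ K : ℝ≥0, LipschitzWith K f}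
  zero_mem' := ⟨rfl, 0, LipschitzWith.const 0⟩
  add_mem' := by
    rintro f g ⟨hf, K, hK⟩ ⟨hg, L, hL⟩
    exact ⟨by simp [hf, hg], K + L, hK.add hL⟩
  smul_mem' := by
    rintro c f ⟨hf, K, hK⟩
    refine ⟨by simp [hf], ‖c‖₊ * K, ?_⟩
    exact (lipschitzWith_smul c).comp hK

/-- `Lip₀(M)`, as a type of its own, so that it carries the Lipschitz norm (defined below) and not
the structures of the space of all functions. -/
def Lip0 {M : Type*} [MetricSpace M] (o : M) : Type _ := ↥(lipSubmodule o)

namespace Lip0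

variable {M : Type*} [MetricSpace M] {o : M}

instance : AddCommGroup (Lip0 o) := inferInstanceAs (AddCommGroup ↥(lipSubmodule o))

instance : Module ℝ (Lip0 o) := inferInstanceAs (Module ℝ ↥(lipSubmodule o))

instance : CoeFun (Lip0 o) (fun _ => M → ℝ) := ⟨fun f => f.1⟩

/-- The Lipschitz norm: the least Lipschitz constant. -/
noncomputable instance : Norm (Lip0 o) :=
  ⟨fun f => sInf {K : ℝ | 0 ≤ K ∧ ∀ x y : M, |f y - f x| ≤ K * dist x y}⟩

theorem norm_def (f : Lip0 o) :
    ‖f‖ = sInf {K : ℝ | 0 ≤ K ∧ ∀ x y : M, |f y - f x| ≤ K * dist x y} := rfl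

@[simp] theorem apply_origin (f : Lip0 o) : f o = 0 := f.2.1

@[simp] theorem add_apply (f g : Lip0 o) (x : M) : (f + g) x = f x + g x := rfl

@[simp] theorem smul_apply (c : ℝ) (f : Lip0 o) (x : M) : (c • f) x = c * f x := rfl

@[simp] theorem zero_apply (x : M) : (0 : Lip0 o) x = 0 := rfl

theorem ext {f g : Lip0 o} (h : ∀ x, f x = g x) : f = g := Subtype.ext (funext h)

theorem norm_nonneg' (f : Lip0 o) : 0 ≤ ‖f‖ := Real.sInf_nonneg fun _ hK => hK.1

theorem norm_le_of (f : Lip0 o) {K : ℝ} (hK : 0 ≤ K)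
    (h : ∀ x y : M, |f y - f x| ≤ K * dist x y) : ‖f‖ ≤ K :=
  csInf_le ⟨0, fun _ h => h.1⟩ ⟨hK, h⟩

theorem abs_sub_le (f : Lip0 o) (x y : M) : |f y - f x| ≤ ‖f‖ * dist x y := by
  obtain ⟨K, hK⟩ := f.2.2
  have hne : {K : ℝ | 0 ≤ K ∧ ∀ x y : M, |f y - f x| ≤ K * dist x y}.Nonempty :=
    ⟨K, K.2, fun x y => by
      have := hK.dist_le_mul y x
      rwa [Real.dist_eq, dist_comm y x] at this⟩
  rcases (dist_nonneg (x := x) (y := y)).eq_or_lt with h | h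
  · have : x = y := dist_eq_zero.1 h.symm
    simp [this]
  · rw [← div_le_iff₀ h]
    refine le_csInf hne fun L hL => ?_
    rw [div_le_iff₀ h]
    exact hL.2 x y

theorem core : NormedSpace.Core ℝ (Lip0 o) where
  norm_nonneg := norm_nonneg'
  norm_smul := by
    have key : ∀ (c : ℝ) (f : Lip0 o), ‖c • f‖ ≤ ‖c‖ * ‖f‖ := fun c f =>
      norm_le_of _ (mul_nonneg (norm_nonneg c) (norm_nonneg' f)) fun x y => by
        rw [smul_apply, smul_apply, ← mul_sub, abs_mul, mul_assoc, Real.norm_eq_abs]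
        exact mul_le_mul_of_nonneg_left (abs_sub_le f x y) (abs_nonneg c)
    intro c f
    refine le_antisymm (key c f) ?_
    rcases eq_or_ne c 0 with rfl | hc
    · simpa using norm_nonneg' _
    · have h := key c⁻¹ (c • f)
      rw [smul_smul, inv_mul_cancel₀ hc, one_smul, norm_inv] at h
      rwa [← le_inv_mul_iff₀ (norm_pos_iff.2 hc)]
  norm_triangle f g :=
    norm_le_of _ (add_nonneg (norm_nonneg' f) (norm_nonneg' g)) fun x y => by
      have h : (f + g) y - (f + g) x = (f y - f x) + (g y - g x) := by
        simp only [add_apply]; ring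
      rw [h, add_mul]
      exact (abs_add_le _ _).trans (add_le_add (abs_sub_le f x y) (abs_sub_le g x y))
  norm_eq_zero_iff f := by
    constructor
    · intro h
      refine ext fun x => ?_
      have := abs_sub_le f o x
      rw [h, zero_mul, apply_origin, sub_zero] at this
      simpa using this
    · rintro rfl
      exact le_antisymm (norm_le_of _ le_rfl fun x y => by simp) (norm_nonneg' _)

noncomputable instance : NormedAddCommGroup (Lip0 o) := NormedAddCommGroup.ofCore core

noncomputable instance : NormedSpace ℝ (Lip0 o) := NormedSpace.ofCore core

/-- The evaluation functional `δ_x : f ↦ f x` on `Lip₀(M)`. -/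
noncomputable def eval (o x : M) : StrongDual ℝ (Lip0 o) :=
  LinearMap.mkContinuous
    { toFun := fun f => f x
      map_add' := fun _ _ => rfl
      map_smul' := fun _ _ => rfl } (dist o x) fun f => by
    have := abs_sub_le f o x
    rw [apply_origin, sub_zero, mul_comm] at this
    exact this

end Lip0

/-- The Lipschitz-free space of `M` with origin `o`: the closed linear span of the evaluation
functionals in the dual of `Lip₀(M)`. -/
noncomputable def LipFree {M : Type*} [MetricSpace M] (o : M) :
    Submodule ℝ (StrongDual ℝ (Lip0 o)) :=
  (Submodule.span ℝ (range (Lip0.eval o))).topologicalClosure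

/-! ### ℝ-trees and the length measure -/

/-- `φ` is an isometry of `[0, d(a,b)]` into `T` with `φ(0) = a` and `φ(d(a,b)) = b`. -/
structure IsGeodesic {T : Type*} [MetricSpace T] (a b : T)
    (φ : Icc (0 : ℝ) (dist a b) → T) : Prop where
  isometry : Isometry φ
  left : φ ⟨0, left_mem_Icc.2 dist_nonneg⟩ = a
  right : φ ⟨dist a b, right_mem_Icc.2 dist_nonneg⟩ = b

/-- `T` is an ℝ-tree. -/
class IsRTree (T : Type*) [MetricSpace T] : Prop where
  existsUnique_geodesic : ∀ a b : T, ∃! φ : Icc (0 : ℝ) (dist a b) → T, IsGeodesic a b φ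
  range_arc : ∀ γ : Icc (0 : ℝ) 1 → T, Continuous γ → Function.Injective γ →
    ∀ φ : Icc (0 : ℝ) (dist (γ 0) (γ 1)) → T, IsGeodesic (γ 0) (γ 1) φ → range γ = range φ

namespace RTree

section

variable {T : Type*} [MetricSpace T] [IsRTree T]

/-- The unique isometry `φ_{xy}` of `[0, d(x,y)]` into `T` from `x` to `y`. -/
noncomputable def geod (x y : T) : Icc (0 : ℝ) (dist x y) → T :=
  (IsRTree.existsUnique_geodesic x y).choose

theorem geod_spec (x y : T) : IsGeodesic x y (geod x y) :=
  (IsRTree.existsUnique_geodesic x y).choose_spec.1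

theorem geod_unique {x y : T} {φ : Icc (0 : ℝ) (dist x y) → T} (h : IsGeodesic x y φ) :
    φ = geod x y :=
  (IsRTree.existsUnique_geodesic x y).choose_spec.2 φ h

/-- The segment `[x, y]`. -/
def seg (x y : T) : Set T := range (geod x y)

/-- `φ_{xy}⁻¹(A)`, as a subset of `[0, d(x,y)] ⊆ ℝ`. -/
def geodPreimage (x y : T) (A : Set T) : Set ℝ :=
  (↑) '' (geod x y ⁻¹' A : Set (Icc (0 : ℝ) (dist x y)))

/-- `A ⊆ T` is measurable if every `φ_{xy}⁻¹(A)` is Lebesgue-measurable. -/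
def IsSegMeasurable (A : Set T) : Prop :=
  ∀ x y : T, NullMeasurableSet (geodPreimage x y A) (volume : Measure ℝ)

/-- `λ_{[x,y]}(A)`: the Lebesgue measure of `φ_{xy}⁻¹(A)`. -/
noncomputable def segLength (x y : T) (A : Set T) : ℝ≥0∞ :=
  (volume : Measure ℝ) (geodPreimage x y A)

/-- A finite family of pairs `(x, y)` whose segments `[x, y]` are pairwise disjoint. -/
def IsDisjointFamily (R : Finset (T × T)) : Prop :=
  (R : Set (T × T)).PairwiseDisjoint fun p => seg p.1 p.2

/-- `λ_R(A)` for the disjoint union `R` of the segments of the family. -/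
noncomputable def famLength (R : Finset (T × T)) (A : Set T) : ℝ≥0∞ :=
  ∑ p ∈ R, segLength p.1 p.2 A

/-- `λ_T(A)`: the supremum of `λ_R(A)` over all finite disjoint unions `R` of segments. -/
noncomputable def treeLength (A : Set T) : ℝ≥0∞ :=
  ⨆ (R : Finset (T × T)) (_ : IsDisjointFamily R), famLength R A

/-! Proof that `treeLength` is countably additive. -/

/-- The union of the segments of a family. -/
def famUnion (R : Finset (T × T)) : Set T := ⋃ p ∈ R, seg p.1 p.2

theorem isClosed_seg (x y : T) : IsClosed (seg x y) :=
  (isCompact_range (geod_spec x y).isometry.continuous).isClosed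

theorem isClosed_famUnion (R : Finset (T × T)) : IsClosed (famUnion R) :=
  R.finite_toSet.isClosed_biUnion fun p _ => isClosed_seg p.1 p.2

theorem famUnion_mono {R S : Finset (T × T)} (h : R ⊆ S) : famUnion R ⊆ famUnion S :=
  biUnion_subset_biUnion_left h

section Hausdorff

variable [MeasurableSpace T] [BorelSpace T]

theorem segLength_eq (x y : T) (A : Set T) : segLength x y A = μH[1] (A ∩ seg x y) := by
  rw [segLength, geodPreimage, ← hausdorffMeasure_real,
    isometry_subtype_coe.hausdorffMeasure_image (Or.inl zero_le_one),
    (geod_spec x y).isometry.hausdorffMeasure_preimage (Or.inl zero_le_one), seg]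

theorem famLength_eq {R : Finset (T × T)} (hR : IsDisjointFamily R) (A : Set T) :
    famLength R A = μH[1] (A ∩ famUnion R) := by
  have hU : MeasurableSet (famUnion R) := (isClosed_famUnion R).measurableSet
  have h : ∀ p ∈ R, MeasurableSet (seg p.1 p.2) := fun p _ => (isClosed_seg p.1 p.2).measurableSet
  rw [inter_comm, ← Measure.restrict_apply hU, famUnion, measure_biUnion_finset hR h, famLength]
  refine Finset.sum_congr rfl fun p hp => ?_
  rw [segLength_eq, Measure.restrict_apply (h p hp), inter_comm]

end Hausdorff

theorem segLength_ne_top (x y : T) (A : Set T) : segLength x y A ≠ ∞ := by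
  refine ne_top_of_le_ne_top (b := volume (Icc (0 : ℝ) (dist x y))) (by simp) ?_
  refine measure_mono ?_
  rintro _ ⟨t, -, rfl⟩
  exact t.2

/-- `φ_{xy}` extended to `ℝ` by constants. -/
noncomputable def geodExt (x y : T) (t : ℝ) : T :=
  geod x y (projIcc 0 (dist x y) dist_nonneg t)

theorem continuous_geodExt (x y : T) : Continuous (geodExt x y) :=
  (geod_spec x y).isometry.continuous.comp continuous_projIcc

theorem geodExt_coe (x y : T) (t : Icc (0 : ℝ) (dist x y)) : geodExt x y t = geod x y t := by
  rw [geodExt, projIcc_val]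

theorem dist_geodExt (x y : T) {s t : ℝ} (hs : s ∈ Icc (0 : ℝ) (dist x y))
    (ht : t ∈ Icc (0 : ℝ) (dist x y)) : dist (geodExt x y s) (geodExt x y t) = dist s t := by
  rw [geodExt, geodExt, (geod_spec x y).isometry.dist_eq, projIcc_of_mem _ hs,
    projIcc_of_mem _ ht]
  rfl

theorem seg_geodExt (x y : T) {a b : ℝ} (ha : 0 ≤ a) (hab : a ≤ b) (hb : b ≤ dist x y) :
    seg (geodExt x y a) (geodExt x y b) = geodExt x y '' Icc a b := by
  have hd : dist (geodExt x y a) (geodExt x y b) = b - a := by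
    rw [dist_geodExt x y ⟨ha, hab.trans hb⟩ ⟨ha.trans hab, hb⟩, dist_comm, Real.dist_eq,
      abs_of_nonneg (sub_nonneg.2 hab)]
  have hmem : ∀ t : Icc (0 : ℝ) (dist (geodExt x y a) (geodExt x y b)),
      a + t ∈ Icc (0 : ℝ) (dist x y) := fun t => by
    have h1 := t.2.1
    have h2 := t.2.2.trans_eq hd
    exact ⟨by linarith, by linarith⟩
  have hg : IsGeodesic (geodExt x y a) (geodExt x y b) (fun t => geodExt x y (a + t)) := by
    refine ⟨Isometry.of_dist_eq fun s t => ?_, ?_, ?_⟩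
    · rw [dist_geodExt x y (hmem s) (hmem t), dist_add_left]
      rfl
    · simp
    · simp [hd]
  rw [seg, ← geod_unique hg]
  ext z
  constructor
  · rintro ⟨t, rfl⟩
    have h1 := t.2.1
    have h2 := t.2.2.trans_eq hd
    exact ⟨a + t, ⟨by linarith, by linarith⟩, rfl⟩
  · rintro ⟨t, ht, rfl⟩
    refine ⟨⟨t - a, by linarith [ht.1], by rw [hd]; linarith [ht.2]⟩, ?_⟩
    simp

/-- A disjoint family can be enlarged so as to cover a given segment up to length `ε`. -/
theorem exists_extend_one {R : Finset (T × T)} (hR : IsDisjointFamily R) (x y : T) {ε : ℝ≥0∞}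
    (hε : 0 < ε) : ∃ R' : Finset (T × T), IsDisjointFamily R' ∧ R ⊆ R' ∧
      segLength x y (famUnion R')ᶜ ≤ ε := by
  classical
  set d := dist x y with hd
  set U : Set ℝ := Ioo 0 d ∩ geodExt x y ⁻¹' (famUnion R)ᶜ with hU
  have hUo : IsOpen U :=
    isOpen_Ioo.inter ((isClosed_famUnion R).isOpen_compl.preimage (continuous_geodExt x y))
  obtain ⟨t, r, htc, htU, hr, hcov, hdisj⟩ :=
    Besicovitch.exists_disjoint_closedBall_covering_ae (volume : Measure ℝ)
      (fun z => {ρ : ℝ | Metric.closedBall z ρ ⊆ U}) U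
      (by
        intro z hz δ hδ
        obtain ⟨ρ, hρ, hsub⟩ := Metric.nhds_basis_closedBall.mem_iff.1 (hUo.mem_nhds hz)
        have hm : 0 < min ρ (δ / 2) := lt_min hρ (by linarith)
        exact ⟨min ρ (δ / 2), (Metric.closedBall_subset_closedBall (min_le_left _ _)).trans hsub,
          hm, (min_le_right _ _).trans_lt (by linarith)⟩)
      (fun _ => 1) (fun _ _ => one_pos)
  have hball : ∀ z ∈ t, Icc (z - r z) (z + r z) ⊆ U := fun z hz => by
    rw [← Real.closedBall_eq_Icc]
    exact (hr z hz).1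
  have hpos : ∀ z ∈ t, 0 < r z := fun z hz => (hr z hz).2.1
  have hUd : U ⊆ Icc 0 d := fun z hz => Ioo_subset_Icc_self hz.1
  have : Countable t := htc.to_subtype
  have hsum : ∑' z : t, volume (Metric.closedBall (z : ℝ) (r z)) ≠ ∞ := by
    rw [← measure_iUnion (fun (a b : t) hab => hdisj a.2 b.2 (fun h => hab (Subtype.ext h)))
      fun z => Metric.isClosed_closedBall.measurableSet]
    refine ne_top_of_le_ne_top (b := volume (Icc (0 : ℝ) d)) (by simp) (measure_mono ?_)
    exact iUnion_subset fun z => ((hr z z.2).1 : _ ⊆ U).trans hUd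
  obtain ⟨s, hs⟩ : ∃ s : Finset t,
      ∑' z : {z // z ∉ s}, volume (Metric.closedBall ((z : t) : ℝ) (r (z : t))) < ε :=
    ((ENNReal.tendsto_tsum_compl_atTop_zero hsum).eventually (gt_mem_nhds hε)).exists
  have hseg : ∀ z : t, seg (geodExt x y (z - r z)) (geodExt x y (z + r z)) =
      geodExt x y '' Icc (z - r z) (z + r z) := fun z => by
    have hp := hpos z z.2
    exact seg_geodExt x y (hUd (hball z z.2 (left_mem_Icc.2 (by linarith)))).1 (by linarith)
      (hUd (hball z z.2 (right_mem_Icc.2 (by linarith)))).2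
  set N : Finset (T × T) :=
    s.image fun z : t => (geodExt x y (z - r z), geodExt x y (z + r z)) with hN
  refine ⟨R ∪ N, ?_, Finset.subset_union_left, ?_⟩
  · have hRN : ∀ p ∈ R, ∀ q ∈ N, Disjoint (seg p.1 p.2) (seg q.1 q.2) := by
      intro p hp q hq
      obtain ⟨z, -, rfl⟩ := Finset.mem_image.1 hq
      rw [hseg, Set.disjoint_right]
      rintro _ ⟨w, hw, rfl⟩ hmem
      exact (hball z z.2 hw).2 (mem_biUnion (x := p) hp hmem)
    intro p hp q hq hpq
    rcases Finset.mem_union.1 (Finset.mem_coe.1 hp) with hp | hp <;>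
      rcases Finset.mem_union.1 (Finset.mem_coe.1 hq) with hq | hq
    · exact hR hp hq hpq
    · exact hRN p hp q hq
    · exact (hRN q hq p hp).symm
    · obtain ⟨z, -, rfl⟩ := Finset.mem_image.1 hp
      obtain ⟨w, -, rfl⟩ := Finset.mem_image.1 hq
      have hzw : (z : ℝ) ≠ w := fun h => hpq (by rw [Subtype.ext h])
      have hd' := hdisj z.2 w.2 hzw
      simp only [Function.onFun, hseg]
      rw [Set.disjoint_left]
      rintro _ ⟨a, ha, rfl⟩ ⟨b, hb, hab⟩
      have : dist b a = 0 := by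
        rw [← dist_geodExt x y (hUd (hball w w.2 hb)) (hUd (hball z z.2 ha)), hab, dist_self]
      rw [dist_eq_zero.1 this] at hb
      simp only [Function.onFun, Real.closedBall_eq_Icc] at hd'
      exact Set.disjoint_left.1 hd' ha hb
  · have hsub : geodPreimage x y (famUnion (R ∪ N))ᶜ ⊆
        ({0, d} : Set ℝ) ∪ ((U \ ⋃ z ∈ t, Metric.closedBall z (r z)) ∪
          ⋃ z : {z // z ∉ s}, Metric.closedBall ((z : t) : ℝ) (r (z : t))) := by
      rintro _ ⟨w, hw, rfl⟩
      by_cases h0 : (w : ℝ) = 0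
      · exact Or.inl (Or.inl h0)
      by_cases h1 : (w : ℝ) = d
      · exact Or.inl (Or.inr h1)
      refine Or.inr ?_
      rw [mem_preimage, ← geodExt_coe] at hw
      have hwU : (w : ℝ) ∈ U := ⟨⟨lt_of_le_of_ne w.2.1 (Ne.symm h0), lt_of_le_of_ne w.2.2 h1⟩,
        fun h => hw (famUnion_mono Finset.subset_union_left h)⟩
      by_cases hc : (w : ℝ) ∈ ⋃ z ∈ t, Metric.closedBall z (r z)
      · refine Or.inr ?_
        obtain ⟨z, hz, hwz⟩ := mem_iUnion₂.1 hc
        refine mem_iUnion.2 ⟨⟨⟨z, hz⟩, fun hzs => hw ?_⟩, hwz⟩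
        refine mem_biUnion (x := (geodExt x y (z - r z), geodExt x y (z + r z)))
          (Finset.mem_coe.2 (Finset.mem_union_right _ (Finset.mem_image_of_mem _ hzs))) ?_
        change geodExt x y w ∈ seg (geodExt x y (z - r z)) (geodExt x y (z + r z))
        rw [hseg ⟨z, hz⟩]
        rw [Real.closedBall_eq_Icc] at hwz
        exact mem_image_of_mem _ hwz
      · exact Or.inl ⟨hwU, hc⟩
    calc segLength x y (famUnion (R ∪ N))ᶜ
        ≤ volume ({0, d} : Set ℝ) + (volume (U \ ⋃ z ∈ t, Metric.closedBall z (r z)) +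
          ∑' z : {z // z ∉ s}, volume (Metric.closedBall ((z : t) : ℝ) (r (z : t)))) :=
        (measure_mono hsub).trans ((measure_union_le _ _).trans (add_le_add le_rfl
          ((measure_union_le _ _).trans (add_le_add le_rfl (measure_iUnion_le _)))))
      _ ≤ ε := by
        rw [hcov, (Set.toFinite ({0, d} : Set ℝ)).measure_zero, zero_add, zero_add]
        exact hs.le

theorem exists_extend {R : Finset (T × T)} (hR : IsDisjointFamily R) (S : Finset (T × T))
    {ε : ℝ≥0∞} (hε : 0 < ε) : ∃ R' : Finset (T × T), IsDisjointFamily R' ∧ R ⊆ R' ∧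
      ∀ p ∈ S, segLength p.1 p.2 (famUnion R')ᶜ ≤ ε := by
  classical
  induction S using Finset.induction_on with
  | empty => exact ⟨R, hR, subset_rfl, by simp⟩
  | insert p S _ ih =>
    obtain ⟨R₁, h1, h2, h3⟩ := ih
    obtain ⟨R₂, h4, h5, h6⟩ := exists_extend_one h1 p.1 p.2 hε
    refine ⟨R₂, h4, h2.trans h5, fun q hq => ?_⟩
    rcases Finset.mem_insert.1 hq with rfl | hq
    · exact h6
    · refine le_trans (measure_mono (image_mono (preimage_mono ?_))) (h3 q hq)
      exact compl_subset_compl.2 (famUnion_mono h5)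

theorem famLength_le_treeLength {R : Finset (T × T)} (hR : IsDisjointFamily R) (A : Set T) :
    famLength R A ≤ treeLength A :=
  le_iSup₂ (f := fun (R : Finset (T × T)) (_ : IsDisjointFamily R) => famLength R A) R hR

theorem geodPreimage_iUnion {ι : Sort*} (x y : T) (A : ι → Set T) :
    geodPreimage x y (⋃ i, A i) = ⋃ i, geodPreimage x y (A i) := by
  rw [geodPreimage, preimage_iUnion, image_iUnion]
  rfl

theorem disjoint_geodPreimage (x y : T) {A B : Set T} (h : Disjoint A B) :
    Disjoint (geodPreimage x y A) (geodPreimage x y B) :=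
  (disjoint_image_iff Subtype.val_injective).2 (h.preimage _)

theorem geodPreimage_compl (x y : T) (A : Set T) :
    geodPreimage x y Aᶜ = Icc 0 (dist x y) \ geodPreimage x y A := by
  rw [geodPreimage, preimage_compl, image_compl_eq_range_sdiff_image Subtype.val_injective,
    Subtype.range_coe]
  rfl

theorem IsSegMeasurable.empty : IsSegMeasurable (∅ : Set T) := fun x y => by
  simp [geodPreimage]

theorem IsSegMeasurable.compl {A : Set T} (hA : IsSegMeasurable A) : IsSegMeasurable Aᶜ :=
  fun x y => by
    rw [geodPreimage_compl]
    exact measurableSet_Icc.nullMeasurableSet.diff (hA x y)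

theorem IsSegMeasurable.iUnion {A : ℕ → Set T} (hA : ∀ i, IsSegMeasurable (A i)) :
    IsSegMeasurable (⋃ i, A i) := fun x y => by
  rw [geodPreimage_iUnion]
  exact NullMeasurableSet.iUnion fun i => hA i x y

theorem famLength_iUnion (R : Finset (T × T)) {A : ℕ → Set T} (hA : ∀ i, IsSegMeasurable (A i))
    (hd : Pairwise (Function.onFun Disjoint A)) :
    famLength R (⋃ i, A i) = ∑' i, famLength R (A i) := by
  simp only [famLength]
  rw [Summable.tsum_finsetSum fun _ _ => ENNReal.summable]
  refine Finset.sum_congr rfl fun p _ => ?_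
  rw [segLength, geodPreimage_iUnion]
  exact measure_iUnion₀ (fun i j hij => (disjoint_geodPreimage _ _ (hd hij)).aedisjoint)
    fun i => hA i p.1 p.2

theorem famLength_union (R : Finset (T × T)) {A B : Set T} (hB : IsSegMeasurable B)
    (hd : Disjoint A B) : famLength R (A ∪ B) = famLength R A + famLength R B := by
  simp only [famLength]
  rw [← Finset.sum_add_distrib]
  refine Finset.sum_congr rfl fun p _ => ?_
  rw [segLength, geodPreimage, preimage_union, image_union]
  exact measure_union₀ (hB p.1 p.2) (disjoint_geodPreimage _ _ hd).aedisjoint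

theorem treeLength_add_le {A B : Set T} (hB : IsSegMeasurable B)
    (hd : Disjoint A B) : treeLength A + treeLength B ≤ treeLength (A ∪ B) := by
  have key : ∀ R : Finset (T × T), IsDisjointFamily R → ∀ S : Finset (T × T),
      IsDisjointFamily S → famLength R A + famLength S B ≤ treeLength (A ∪ B) := by
    intro R hR S hS
    refine ENNReal.le_of_forall_pos_le_add fun ε hε _ => ?_
    have hδ : (0 : ℝ≥0∞) < ε / S.card :=
      ENNReal.div_pos (by simpa using hε.ne') (ENNReal.natCast_ne_top _)
    obtain ⟨R', hR', hRR', hS'⟩ := exists_extend hR S hδ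
    borelize T
    have h1 : famLength R A ≤ famLength R' A := Finset.sum_le_sum_of_subset hRR'
    have h2 : famLength S (famUnion R')ᶜ ≤ ε :=
      (Finset.sum_le_card_nsmul S _ _ hS').trans (by
        rw [nsmul_eq_mul]
        exact ENNReal.mul_div_le)
    have h3 : famLength S B ≤ famLength R' B + famLength S (famUnion R')ᶜ := by
      rw [famLength_eq hS, famLength_eq hR', famLength_eq hS]
      refine (measure_mono ?_).trans (measure_union_le _ _)
      rintro z ⟨hz, hzS⟩
      by_cases h : z ∈ famUnion R'
      · exact Or.inl ⟨hz, h⟩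
      · exact Or.inr ⟨h, hzS⟩
    calc famLength R A + famLength S B
        ≤ famLength R' A + (famLength R' B + ε) :=
          add_le_add h1 (h3.trans (add_le_add le_rfl h2))
      _ = famLength R' (A ∪ B) + ε := by rw [famLength_union R' hB hd, add_assoc]
      _ ≤ treeLength (A ∪ B) + ε := add_le_add (famLength_le_treeLength hR' _) le_rfl
  have hne : IsDisjointFamily (∅ : Finset (T × T)) := by simp [IsDisjointFamily]
  exact ENNReal.biSup_add_biSup_le' ⟨∅, hne⟩ ⟨∅, hne⟩ key

theorem treeLength_iUnion {A : ℕ → Set T} (hA : ∀ i, IsSegMeasurable (A i))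
    (hd : Pairwise (Function.onFun Disjoint A)) :
    treeLength (⋃ i, A i) = ∑' i, treeLength (A i) := by
  refine le_antisymm (iSup₂_le fun R hR => ?_) ?_
  · rw [famLength_iUnion R hA hd]
    exact ENNReal.tsum_le_tsum fun i => famLength_le_treeLength hR _
  · have hmono : ∀ {B C : Set T}, B ⊆ C → treeLength B ≤ treeLength C := fun h =>
      iSup₂_mono fun R _ => Finset.sum_le_sum fun p _ =>
        measure_mono (image_mono (preimage_mono h))
    have hfin : ∀ n : ℕ, ∑ i ∈ Finset.range n, treeLength (A i) ≤
        treeLength (⋃ i ∈ Finset.range n, A i) := by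
      intro n
      induction n with
      | zero => simp
      | succ n ih =>
        have hdn : Disjoint (⋃ i ∈ Finset.range n, A i) (A n) := by
          simp only [disjoint_iUnion_left, Finset.mem_range]
          exact fun i hi => hd hi.ne
        rw [Finset.sum_range_succ, Finset.range_add_one, Finset.set_biUnion_insert, union_comm]
        exact (add_le_add ih le_rfl).trans (treeLength_add_le (hA n) hdn)
    rw [ENNReal.tsum_eq_iSup_nat]
    exact iSup_le fun n => (hfin n).trans (hmono (iUnion₂_subset_iUnion _ _))

end

/-- The σ-algebra of measurable subsets of `T`. -/
@[reducible] def segMeasurableSpace (T : Type*) [MetricSpace T] [IsRTree T] :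
    MeasurableSpace T where
  MeasurableSet' A := IsSegMeasurable A
  measurableSet_empty := IsSegMeasurable.empty
  measurableSet_compl _ hA := hA.compl
  measurableSet_iUnion _ hA := IsSegMeasurable.iUnion hA

/-- The length measure `λ_T`, the measure `A ↦ treeLength A` on the measurable subsets of `T`. -/
noncomputable def lengthMeasure (T : Type*) [MetricSpace T] [IsRTree T] :
    @Measure T (segMeasurableSpace T) :=
  @Measure.ofMeasurable T (segMeasurableSpace T) (fun A _ => treeLength A)
    (by simp [treeLength, famLength, segLength, geodPreimage])
    fun _ hA hd => treeLength_iUnion hA hd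

/-- `λ_T(A) = sup_R λ_R(A)` for measurable `A`. -/
theorem lengthMeasure_apply (T : Type*) [MetricSpace T] [IsRTree T] {A : Set T}
    (hA : IsSegMeasurable A) : lengthMeasure T A = treeLength A :=
  @Measure.ofMeasurable_apply T (segMeasurableSpace T) _ _ _ A hA

end RTree

/-! The isometry sends `δ_x` to the indicator of `[o,x]`. It suffices that `‖∑ a_x δ_x‖ = ‖∑ a_x
1_{[o,x]}‖₁` for finite sums, and that the indicators span a dense subspace of `L¹`.

Upper bound (`abs_sum_le_of_branch_mem`): once the finite set is closed under branch points, it is a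
finite rooted tree. The step function is constant on each edge, and `∑ a_x f(x)` is the sum over the
edges of that constant times the increment of `f`, which is at most the Lipschitz constant times the
length of the edge. Lower bound (`exists_lip0_sum_eq`): integrating the sign of the step function
along `[o,x]` gives a 1-Lipschitz function of `x`, because `[o,x]` and `[o,y]` differ only inside
`[x,y]`; this function attains the `L¹` norm.

Density (`eq_top_of_hasIndicator_seg`): the initial pieces of `[o,x]` generate its Borel sets, and a
set of finite measure lies, up to small measure, in finitely many segments `[o,x]`.

If `T` is separable, countably many segments `[o,x]` cover it up to a null set. The length measure
is then σ-finite, and the index of a segment together with the distance from `o` is a coordinate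
without atoms that determines the measurable sets modulo null sets. A positive density makes the
measure a probability, and the distribution function carries it to Lebesgue measure on `[0,1]`. -/

namespace RTree

/-! ### Segments, branch points and the root order. -/

section Geometry

variable {T : Type*} [MetricSpace T] [IsRTree T]

theorem geodExt_zero (x y : T) : geodExt x y 0 = x := by
  have := geodExt_coe x y ⟨0, left_mem_Icc.2 dist_nonneg⟩
  rw [(geod_spec x y).left] at this
  exact this

theorem geodExt_dist (x y : T) : geodExt x y (dist x y) = y := by
  have := geodExt_coe x y ⟨dist x y, right_mem_Icc.2 dist_nonneg⟩
  rw [(geod_spec x y).right] at this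
  exact this

theorem seg_eq_image (x y : T) : seg x y = geodExt x y '' Icc 0 (dist x y) := by
  have := seg_geodExt x y le_rfl dist_nonneg le_rfl
  rwa [geodExt_zero, geodExt_dist] at this

theorem dist_left_geodExt (x y : T) {t : ℝ} (ht : t ∈ Icc (0 : ℝ) (dist x y)) :
    dist x (geodExt x y t) = t := by
  have := dist_geodExt x y (left_mem_Icc.2 dist_nonneg) ht
  rw [geodExt_zero] at this
  rw [this, dist_comm, Real.dist_eq, sub_zero, abs_of_nonneg ht.1]

theorem dist_right_geodExt (x y : T) {t : ℝ} (ht : t ∈ Icc (0 : ℝ) (dist x y)) :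
    dist (geodExt x y t) y = dist x y - t := by
  have := dist_geodExt x y ht (right_mem_Icc.2 dist_nonneg)
  rw [geodExt_dist] at this
  rw [this, dist_comm, Real.dist_eq, abs_of_nonneg (sub_nonneg.2 ht.2)]

theorem geodExt_mem_seg (x y : T) {t : ℝ} (ht : t ∈ Icc (0 : ℝ) (dist x y)) :
    geodExt x y t ∈ seg x y := by
  rw [seg_eq_image]
  exact mem_image_of_mem _ ht

/-- Two geodesics fit together if their lengths add up to the distance of the endpoints. -/
theorem isGeodesic_concat {x y z : T} (h : dist x z + dist z y = dist x y) :
    IsGeodesic x y fun t => if (t : ℝ) ≤ dist x z then geodExt x z t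
      else geodExt z y (t - dist x z) := by
  have key : ∀ s t : Icc (0 : ℝ) (dist x y), (s : ℝ) ≤ t →
      dist (if (s : ℝ) ≤ dist x z then geodExt x z s else geodExt z y (s - dist x z))
        (if (t : ℝ) ≤ dist x z then geodExt x z t else geodExt z y (t - dist x z)) = t - s := by
    intro s t hst
    have hs := s.2
    have ht := t.2
    simp only [mem_Icc] at hs ht
    by_cases h1 : (t : ℝ) ≤ dist x z
    · rw [if_pos h1, if_pos (hst.trans h1), dist_geodExt x z ⟨hs.1, hst.trans h1⟩ ⟨ht.1, h1⟩,
        dist_comm, Real.dist_eq, abs_of_nonneg (by linarith)]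
    · rw [if_neg h1]
      rw [not_le] at h1
      have ht' : (t : ℝ) - dist x z ∈ Icc (0 : ℝ) (dist z y) := ⟨by linarith, by linarith⟩
      by_cases h2 : (s : ℝ) ≤ dist x z
      · rw [if_pos h2]
        have hs' : (s : ℝ) ∈ Icc (0 : ℝ) (dist x z) := ⟨hs.1, h2⟩
        have e1 := dist_left_geodExt x z hs'
        have e2 := dist_right_geodExt x z hs'
        have e3 := dist_left_geodExt z y ht'
        have e4 := dist_right_geodExt z y ht'
        have t1 := dist_triangle (geodExt x z s) z (geodExt z y (t - dist x z))
        have t2 := dist_triangle4 x (geodExt x z s) (geodExt z y (t - dist x z)) y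
        linarith
      · rw [if_neg h2]
        rw [not_le] at h2
        rw [dist_geodExt z y ⟨by linarith, by linarith⟩ ht', dist_comm, Real.dist_eq,
          abs_of_nonneg (by linarith)]
        ring
  refine ⟨Isometry.of_dist_eq fun s t => ?_, ?_, ?_⟩
  · rcases le_total (s : ℝ) t with hst | hst
    · rw [key s t hst, dist_comm s t, Subtype.dist_eq, Real.dist_eq, abs_of_nonneg (by linarith)]
    · rw [dist_comm, key t s hst, Subtype.dist_eq, Real.dist_eq, abs_of_nonneg (by linarith)]
  · simp [geodExt_zero]
  · simp only
    split_ifs with h1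
    · have h0 : dist z y = 0 := le_antisymm (by linarith) dist_nonneg
      have hz := dist_eq_zero.1 h0
      subst hz
      exact geodExt_dist x z
    · rw [← h, add_sub_cancel_left, geodExt_dist]

/-- The converse is uniqueness of geodesics: the path through `z` is itself the geodesic from `x` to
`y`. Betweenness thus becomes an equation of distances, and the facts below reduce to triangle
inequalities. -/
theorem mem_seg_iff {x y z : T} : z ∈ seg x y ↔ dist x z + dist z y = dist x y := by
  constructor
  · rw [seg_eq_image]
    rintro ⟨t, ht, rfl⟩
    rw [dist_left_geodExt x y ht, dist_right_geodExt x y ht]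
    ring
  · intro h
    rw [seg, ← geod_unique (isGeodesic_concat h)]
    refine ⟨⟨dist x z, dist_nonneg, by linarith [dist_nonneg (x := z) (y := y)]⟩, ?_⟩
    simp [geodExt_dist]

theorem seg_comm (x y : T) : seg x y = seg y x := by
  ext z
  rw [mem_seg_iff, mem_seg_iff, dist_comm x z, dist_comm z y, dist_comm x y, add_comm]

theorem left_mem_seg (x y : T) : x ∈ seg x y := by simp [mem_seg_iff]

theorem right_mem_seg (x y : T) : y ∈ seg x y := by simp [mem_seg_iff]

@[simp] theorem seg_self (x : T) : seg x x = {x} := by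
  ext z
  rw [mem_seg_iff, dist_self, mem_singleton_iff, dist_comm z x, ← two_mul, mul_eq_zero,
    dist_eq_zero, eq_comm (a := z)]
  simp

theorem dist_of_mem_seg {o x z w : T} (hz : z ∈ seg o x) (hw : w ∈ seg o x) :
    dist z w = |dist o z - dist o w| := by
  rw [seg_eq_image] at hz hw
  obtain ⟨s, hs, rfl⟩ := hz
  obtain ⟨t, ht, rfl⟩ := hw
  rw [dist_geodExt o x hs ht, dist_left_geodExt o x hs, dist_left_geodExt o x ht, Real.dist_eq]

theorem mem_seg_of_dist_le {o x z w : T} (hz : z ∈ seg o x) (hw : w ∈ seg o x)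
    (h : dist o z ≤ dist o w) : z ∈ seg o w := by
  rw [mem_seg_iff, dist_of_mem_seg hz hw, abs_of_nonpos (by linarith)]
  ring

theorem dist_left_le_of_mem_seg {o x z : T} (hz : z ∈ seg o x) : dist o z ≤ dist o x := by
  have := mem_seg_iff.1 hz
  linarith [dist_nonneg (x := z) (y := x)]

theorem mem_seg_trans {o x y z : T} (hx : x ∈ seg o y) (hy : y ∈ seg o z) : x ∈ seg o z := by
  rw [mem_seg_iff] at *
  have h1 := dist_triangle x y z
  have h2 := dist_triangle o x z
  linarith

theorem mem_seg_right {o x y z : T} (hx : x ∈ seg o y) (hy : y ∈ seg o z) : y ∈ seg x z := by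
  rw [mem_seg_iff] at *
  have h1 := dist_triangle x y z
  have h2 := dist_triangle o x z
  linarith

theorem seg_subset_seg {o y z : T} (hy : y ∈ seg o z) : seg o y ⊆ seg o z :=
  fun _ hx => mem_seg_trans hx hy

theorem seg_antisymm {o x y : T} (hx : x ∈ seg o y) (hy : y ∈ seg o x) : x = y := by
  rw [mem_seg_iff] at *
  rw [dist_comm y x] at hy
  exact dist_eq_zero.1 (by linarith)

/-- An injective path made of two geodesics runs through the segment of its endpoints. -/
theorem mem_seg_of_inter_eq {x y m : T} (h : ∀ z ∈ seg x m, z ∈ seg m y → z = m) :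
    m ∈ seg x y := by
  rcases eq_or_ne x m with rfl | hxm
  · exact left_mem_seg _ _
  rcases eq_or_ne m y with rfl | hmy
  · exact right_mem_seg _ _
  have ha : 0 < dist x m := dist_pos.2 hxm
  have hb : 0 < dist m y := dist_pos.2 hmy
  set γ : Icc (0 : ℝ) 1 → T := fun t => if (t : ℝ) ≤ 1 / 2 then geodExt x m (2 * t * dist x m)
    else geodExt m y ((2 * t - 1) * dist m y) with hγ
  have hm1 : ∀ t : Icc (0 : ℝ) 1, (t : ℝ) ≤ 1 / 2 → 2 * (t : ℝ) * dist x m ∈ Icc 0 (dist x m) :=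
    fun t ht => ⟨by have := t.2.1; positivity, by nlinarith⟩
  have hm2 : ∀ t : Icc (0 : ℝ) 1, ¬ (t : ℝ) ≤ 1 / 2 →
      (2 * (t : ℝ) - 1) * dist m y ∈ Icc 0 (dist m y) := fun t ht => by
    rw [not_le] at ht
    have := t.2.2
    exact ⟨mul_nonneg (by linarith) hb.le, by nlinarith⟩
  have hcont : Continuous γ := by
    refine Continuous.if_le ?_ ?_ continuous_subtype_val continuous_const ?_
    · exact (continuous_geodExt x m).comp (by fun_prop)
    · exact (continuous_geodExt m y).comp (by fun_prop)
    · intro t ht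
      rw [ht]
      norm_num [geodExt_dist, geodExt_zero]
  -- A value common to both halves could only be `m`, but the second half has left `m` as soon as `t
  -- > 1/2`.
  have hcross : ∀ s t : Icc (0 : ℝ) 1, (s : ℝ) ≤ 1 / 2 → ¬ (t : ℝ) ≤ 1 / 2 → γ s ≠ γ t := by
    intro s t hs ht hst
    simp only [hγ, if_pos hs, if_neg ht] at hst
    have h1 := h _ (geodExt_mem_seg x m (hm1 s hs)) (hst ▸ geodExt_mem_seg m y (hm2 t ht))
    rw [hst] at h1
    have h2 := dist_left_geodExt m y (hm2 t ht)
    rw [h1, dist_self] at h2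
    rw [not_le] at ht
    rcases mul_eq_zero.1 h2.symm with h3 | h3 <;> linarith
  have hinj : Function.Injective γ := by
    intro s t hst
    by_cases hs : (s : ℝ) ≤ 1 / 2 <;> by_cases ht : (t : ℝ) ≤ 1 / 2
    · simp only [hγ, if_pos hs, if_pos ht] at hst
      have h1 := dist_left_geodExt x m (hm1 s hs)
      rw [hst, dist_left_geodExt x m (hm1 t ht)] at h1
      have h2 := mul_right_cancel₀ ha.ne' h1
      exact Subtype.ext (by linarith)
    · exact absurd hst (hcross s t hs ht)
    · exact absurd hst.symm (hcross t s ht hs)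
    · simp only [hγ, if_neg hs, if_neg ht] at hst
      have h1 := dist_left_geodExt m y (hm2 s hs)
      rw [hst, dist_left_geodExt m y (hm2 t ht)] at h1
      have h2 := mul_right_cancel₀ hb.ne' h1
      exact Subtype.ext (by linarith)
  -- The only use of the arc condition in the definition of an ℝ-tree.
  have hr : range γ = seg (γ 0) (γ 1) := IsRTree.range_arc γ hcont hinj _ (geod_spec _ _)
  have h0 : γ 0 = x := by simp [hγ, geodExt_zero]
  have h1 : γ 1 = y := by
    have : ¬ (1 : ℝ) ≤ 1 / 2 := by norm_num
    simp only [hγ, Icc.coe_one, if_neg this]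
    norm_num [geodExt_dist]
  rw [h0, h1] at hr
  rw [← hr]
  refine ⟨⟨1 / 2, by norm_num, by norm_num⟩, ?_⟩
  simp [hγ, geodExt_dist]

/-- On the way from `x` to `o`, take the first point `m` of the closed set `[o,y]`. Before `m` the
path avoids `[o,y]`, so `[x,m]` and `[m,y]` meet only in `m`, and `mem_seg_of_inter_eq` applies. -/
theorem exists_median (o x y : T) : ∃ m, m ∈ seg o x ∧ m ∈ seg o y ∧ m ∈ seg x y := by
  have hc : IsCompact (Icc 0 (dist x o) ∩ geodExt x o ⁻¹' seg o y) :=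
    isCompact_Icc.inter_right ((isClosed_seg o y).preimage (continuous_geodExt x o))
  have hne : (Icc 0 (dist x o) ∩ geodExt x o ⁻¹' seg o y).Nonempty :=
    ⟨dist x o, right_mem_Icc.2 dist_nonneg, by
      rw [mem_preimage, geodExt_dist]; exact left_mem_seg _ _⟩
  obtain ⟨t, ⟨ht, hty⟩, hmin⟩ := hc.exists_isLeast hne
  rw [mem_preimage] at hty
  have hmx := geodExt_mem_seg x o ht
  refine ⟨geodExt x o t, seg_comm x o ▸ hmx, hty, mem_seg_of_inter_eq fun z hz hzy => ?_⟩
  have hzx := mem_seg_trans hz hmx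
  have hzy' : z ∈ seg o y := by
    rw [seg_comm] at hty hzy ⊢
    exact mem_seg_trans hzy hty
  have h1 : t ≤ dist x z := by
    refine hmin ⟨⟨dist_nonneg, dist_left_le_of_mem_seg hzx⟩, ?_⟩
    rw [seg_eq_image] at hzx
    obtain ⟨s, hs, rfl⟩ := hzx
    rwa [mem_preimage, dist_left_geodExt x o hs]
  have h2 := mem_seg_iff.1 hz
  rw [dist_left_geodExt x o ht] at h2
  exact dist_eq_zero.1 (le_antisymm (by linarith) dist_nonneg)

/-- The point where the segments from `o` to `x` and from `o` to `y` branch. -/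
noncomputable def branch (o x y : T) : T := (exists_median o x y).choose

theorem branch_mem_left (o x y : T) : branch o x y ∈ seg o x :=
  (exists_median o x y).choose_spec.1

theorem branch_mem_right (o x y : T) : branch o x y ∈ seg o y :=
  (exists_median o x y).choose_spec.2.1

theorem branch_mem_seg (o x y : T) : branch o x y ∈ seg x y :=
  (exists_median o x y).choose_spec.2.2

/-- The segments share nothing beyond the branch point: a common point `z` further out would give a
path from `x` to `y` shorter than the one through the branch point, by twice the distance from it to
`z`. -/
theorem mem_seg_branch {o x y z : T} (hx : z ∈ seg o x) (hy : z ∈ seg o y) :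
    z ∈ seg o (branch o x y) := by
  have hmx := branch_mem_left o x y
  have hmy := branch_mem_right o x y
  rcases le_total (dist o z) (dist o (branch o x y)) with h | h
  · exact mem_seg_of_dist_le hx hmx h
  · have h1 := mem_seg_iff.1 (mem_seg_right (mem_seg_of_dist_le hmx hx h) hx)
    have h2 := mem_seg_iff.1 (mem_seg_right (mem_seg_of_dist_le hmy hy h) hy)
    have h3 := mem_seg_iff.1 (branch_mem_seg o x y)
    have h4 := dist_triangle x z y
    have h5 : dist (branch o x y) z = 0 := by
      rw [dist_comm x z] at h4
      rw [dist_comm x] at h3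
      exact le_antisymm (by linarith) dist_nonneg
    rw [dist_eq_zero.1 h5]
    exact right_mem_seg _ _

/-- Up to the branch point `[o,x]` runs inside `[o,y]`, and after it inside `[x,y]`. -/
theorem seg_subset_union (o x y : T) : seg o x ⊆ seg o y ∪ seg x y := by
  intro z hz
  rcases le_total (dist o z) (dist o (branch o x y)) with h | h
  · exact Or.inl (mem_seg_trans (mem_seg_of_dist_le hz (branch_mem_left o x y) h)
      (branch_mem_right o x y))
  · have h1 := mem_seg_right (mem_seg_of_dist_le (branch_mem_left o x y) hz h) hz
    rw [seg_comm] at h1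
    exact Or.inr (mem_seg_trans h1 (branch_mem_seg o x y))

/-- The order of the tree with root `o`. -/
@[reducible] noncomputable def rootOrder (o : T) : SemilatticeInf T where
  le x y := x ∈ seg o y
  le_refl x := right_mem_seg o x
  le_trans _ _ _ := mem_seg_trans
  le_antisymm _ _ := seg_antisymm
  inf := branch o
  inf_le_left := branch_mem_left o
  inf_le_right := branch_mem_right o
  le_inf _ _ _ := mem_seg_branch

/-- Branch points are meets in the root order, and the meet closure of a finite set is finite. -/
theorem exists_finset_branch_mem (o : T) (S : Finset T) :
    ∃ S' : Finset T, S ⊆ S' ∧ o ∈ S' ∧ ∀ x ∈ S', ∀ y ∈ S', branch o x y ∈ S' := by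
  classical
  let _ := rootOrder o
  have hf : (infClosure (insert o S : Set T)).Finite := (S.finite_toSet.insert o).infClosure
  refine ⟨hf.toFinset, fun x hx => ?_, ?_, fun x hx y hy => ?_⟩
  · exact hf.mem_toFinset.2 (subset_infClosure (mem_insert_of_mem _ hx))
  · exact hf.mem_toFinset.2 (subset_infClosure (mem_insert _ _))
  · rw [hf.mem_toFinset] at *
    exact infClosed_infClosure hx hy

end Geometry

end RTree

/-! ### The length measure on segments. -/

namespace RTree

section LengthMeasure

variable {T : Type*} [MetricSpace T] [IsRTree T]

/-- Each `famLength` is one-dimensional Hausdorff measure restricted to a subset, so the family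
consisting of `[x,y]` alone already attains the supremum. -/
theorem treeLength_inter_seg (A : Set T) (x y : T) :
    treeLength (A ∩ seg x y) = segLength x y A := by
  borelize T
  refine le_antisymm (iSup₂_le fun R hR => ?_) ?_
  · rw [famLength_eq hR, segLength_eq]
    exact measure_mono inter_subset_left
  · have h : IsDisjointFamily ({(x, y)} : Finset (T × T)) := by simp [IsDisjointFamily]
    refine le_trans ?_ (famLength_le_treeLength h _)
    rw [famLength, Finset.sum_singleton, segLength_eq, segLength_eq, inter_assoc, inter_self]

theorem treeLength_eq_zero {N : Set T} (h : ∀ x y, (N ∩ seg x y).Countable) :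
    treeLength N = 0 := by
  borelize T
  refine le_antisymm (iSup₂_le fun R hR => ?_) zero_le
  rw [famLength, Finset.sum_eq_zero]
  intro p _
  rw [segLength_eq]
  have := Measure.nullSingletonClass_hausdorff T one_pos
  exact (h p.1 p.2).measure_zero _

theorem segLength_univ (x y : T) : segLength x y univ = ENNReal.ofReal (dist x y) := by
  rw [segLength, geodPreimage, preimage_univ, image_univ, Subtype.range_coe, Real.volume_Icc,
    sub_zero]

theorem geodPreimage_subset_iff {x y : T} {A : Set T} {C : Set ℝ} :
    geodPreimage x y A ⊆ C ↔ ∀ z ∈ seg x y, z ∈ A → dist x z ∈ C := by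
  constructor
  · intro h z hz hA
    rw [seg_eq_image] at hz
    obtain ⟨t, ht, rfl⟩ := hz
    rw [dist_left_geodExt x y ht]
    exact h ⟨⟨t, ht⟩, by rwa [mem_preimage, ← geodExt_coe], rfl⟩
  · rintro h _ ⟨t, ht, rfl⟩
    rw [mem_preimage, ← geodExt_coe] at ht
    have := h _ (geodExt_mem_seg x y t.2) ht
    rwa [dist_left_geodExt x y t.2] at this

theorem isSegMeasurable_of_isClosed {F : Set T} (hF : IsClosed F) : IsSegMeasurable F :=
  fun x y => by
    have : geodPreimage x y F = Icc 0 (dist x y) ∩ geodExt x y ⁻¹' F := by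
      ext t
      constructor
      · rintro ⟨s, hs, rfl⟩
        rw [mem_preimage, ← geodExt_coe] at hs
        exact ⟨s.2, hs⟩
      · rintro ⟨h1, h2⟩
        exact ⟨⟨t, h1⟩, by rwa [mem_preimage, ← geodExt_coe], rfl⟩
    rw [this]
    exact (isClosed_Icc.inter (hF.preimage (continuous_geodExt x y))).measurableSet.nullMeasurableSet

attribute [local instance] segMeasurableSpace

instance : OpensMeasurableSpace T where
  borel_le := by
    rw [borel_eq_generateFrom_isClosed]
    exact MeasurableSpace.generateFrom_le fun F hF => isSegMeasurable_of_isClosed hF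

theorem measurableSet_seg (x y : T) : MeasurableSet (seg x y) := (isClosed_seg x y).measurableSet

theorem measurable_dist_left (o : T) : Measurable (dist o) :=
  (continuous_const.dist continuous_id).measurable

theorem lengthMeasure_inter_seg {A : Set T} (hA : MeasurableSet A) (x y : T) :
    lengthMeasure T (A ∩ seg x y) = segLength x y A := by
  rw [lengthMeasure_apply T (hA.inter (measurableSet_seg x y)), treeLength_inter_seg]

theorem lengthMeasure_seg (x y : T) :
    lengthMeasure T (seg x y) = ENNReal.ofReal (dist x y) := by
  rw [← segLength_univ, ← lengthMeasure_inter_seg MeasurableSet.univ, univ_inter]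

theorem lengthMeasure_seg_ne_top (x y : T) : lengthMeasure T (seg x y) ≠ ∞ := by
  rw [lengthMeasure_seg]
  exact ENNReal.ofReal_ne_top

instance : NullSingletonClass (lengthMeasure T) where
  measure_singleton x := by
    rw [← seg_self, lengthMeasure_seg, dist_self, ENNReal.ofReal_zero]

theorem lengthMeasure_eq_zero {N : Set T} (hN : MeasurableSet N)
    (h : ∀ x y, (N ∩ seg x y).Countable) : lengthMeasure T N = 0 := by
  rw [lengthMeasure_apply T hN, treeLength_eq_zero h]

/-- Up to null sets, the measurable subsets of a segment are given by Borel sets of reals. -/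
theorem exists_ae_eq_preimage_dist {A : Set T} (hA : MeasurableSet A) (o x : T) :
    ∃ C : Set ℝ, MeasurableSet C ∧
      (A ∩ seg o x : Set T) =ᵐ[lengthMeasure T] (dist o ⁻¹' C ∩ seg o x : Set T) := by
  -- A Borel hull of the Lebesgue measurable set `φ_{ox}⁻¹(A)`; on `[o,x]` the function `dist o`
  -- inverts `φ_{ox}`.
  obtain ⟨C, hC, hCm, hCe⟩ := (show IsSegMeasurable A from hA) o x
    |>.exists_measurable_superset_ae_eq
  refine ⟨C, hCm, ?_⟩
  have hm : MeasurableSet (dist o ⁻¹' C : Set T) := measurable_dist_left o hCm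
  have hsub := geodPreimage_subset_iff.1 hC
  refine (ae_eq_set.2 ⟨?_, ?_⟩)
  · have : (A ∩ seg o x) \ (dist o ⁻¹' C ∩ seg o x) = ∅ := by
      rw [sdiff_eq_empty]
      exact fun z hz => ⟨hsub z hz.2 hz.1, hz.2⟩
    rw [this, measure_empty]
  · have : (dist o ⁻¹' C ∩ seg o x) \ (A ∩ seg o x) = (dist o ⁻¹' C \ A) ∩ seg o x := by
      ext z
      simp only [mem_sdiff, mem_inter_iff]
      tauto
    rw [this, lengthMeasure_inter_seg (hm.diff hA), segLength]
    refine measure_mono_null ?_ (ae_eq_set.1 hCe).1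
    rw [geodPreimage_subset_iff]
    rintro z hz ⟨hzC, hzA⟩
    refine ⟨hzC, ?_⟩
    rintro ⟨t, ht, h⟩
    rw [mem_preimage, ← geodExt_coe] at ht
    apply hzA
    have h2 : dist z (geodExt o x t) = 0 := by
      rw [dist_of_mem_seg hz (geodExt_mem_seg o x t.2), dist_left_geodExt o x t.2, h]
      simp
    rwa [dist_eq_zero.1 h2]

/-- The union of the segments from the root to the points of a finite set. -/
def finsetUnion (o : T) (Z : Finset T) : Set T := ⋃ z ∈ Z, seg o z

theorem measurableSet_finsetUnion (o : T) (Z : Finset T) : MeasurableSet (finsetUnion o Z) :=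
  Z.measurableSet_biUnion fun z _ => measurableSet_seg o z

/-- A disjoint family that nearly attains the supremum misses little of `A`, and each of its
segments `[p,q]` lies in `[o,p] ∪ [o,q]`. -/
theorem exists_finset_lengthMeasure_diff_le (o : T) {A : Set T} (hA : MeasurableSet A)
    (hfin : lengthMeasure T A ≠ ∞) {ε : ℝ≥0∞} (hε : ε ≠ 0) :
    ∃ Z : Finset T, lengthMeasure T (A \ finsetUnion o Z) ≤ ε := by
  classical
  have h0 : IsDisjointFamily (∅ : Finset (T × T)) := by simp [IsDisjointFamily]
  have hR : ∃ R : Finset (T × T), IsDisjointFamily R ∧ lengthMeasure T A ≤ famLength R A + ε := by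
    rcases eq_or_ne (lengthMeasure T A) 0 with h | h
    · exact ⟨∅, h0, by rw [h]; exact zero_le⟩
    have hlt : lengthMeasure T A - ε < treeLength A := by
      rw [← lengthMeasure_apply T hA]
      exact ENNReal.sub_lt_self hfin h hε
    obtain ⟨R, hlt⟩ := lt_iSup_iff.1 hlt
    obtain ⟨hR, hlt⟩ := lt_iSup_iff.1 hlt
    exact ⟨R, hR, tsub_le_iff_right.1 hlt.le⟩
  obtain ⟨R, hR, hle⟩ := hR
  have hm : MeasurableSet (famUnion R) := (isClosed_famUnion R).measurableSet
  have hfam : famLength R A = lengthMeasure T (A ∩ famUnion R) := by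
    rw [famLength, famUnion, inter_iUnion₂, measure_biUnion_finset]
    · exact Finset.sum_congr rfl fun p _ => (lengthMeasure_inter_seg hA _ _).symm
    · exact fun p hp q hq hpq => (hR hp hq hpq).mono inter_subset_right inter_subset_right
    · exact fun p _ => hA.inter (measurableSet_seg _ _)
  have hd : lengthMeasure T (A \ famUnion R) ≤ ε := by
    rw [hfam, ← measure_inter_add_sdiff A hm] at hle
    exact (ENNReal.add_le_add_iff_left (measure_ne_top_of_subset inter_subset_left hfin)).1 hle
  refine ⟨R.image Prod.fst ∪ R.image Prod.snd, (measure_mono ?_).trans hd⟩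
  refine sdiff_subset_sdiff_right (iUnion₂_subset fun p hp z hz => ?_)
  rw [seg_comm] at hz
  have h1 := seg_subset_union p.2 p.1 o hz
  rw [seg_comm p.2 o, seg_comm p.1 o] at h1
  rcases h1 with h1 | h1
  · exact mem_biUnion (x := p.2) (by simpa using Or.inr ⟨p.1, hp⟩) h1
  · exact mem_biUnion (x := p.1) (by simpa using Or.inl ⟨p.2, hp⟩) h1

end LengthMeasure

end RTree

/-! ### Indicators in closed subspaces of `L¹`. -/

section Indicator

variable {α : Type*} {m : MeasurableSpace α} {μ : Measure α}

/-- The indicator function of `s` belongs to the subspace `W` of `L¹`. -/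
def HasIndicator (W : Submodule ℝ (Lp ℝ 1 μ)) (s : Set α) : Prop :=
  ∃ φ ∈ W, (φ : α → ℝ) =ᵐ[μ] s.indicator fun _ => 1

namespace HasIndicator

variable {W : Submodule ℝ (Lp ℝ 1 μ)} {s t : Set α}

theorem congr (hs : HasIndicator W s) (h : t =ᵐ[μ] s) : HasIndicator W t := by
  obtain ⟨φ, hφ, he⟩ := hs
  exact ⟨φ, hφ, he.trans (indicator_ae_eq_of_ae_eq_set h.symm)⟩

theorem empty (W : Submodule ℝ (Lp ℝ 1 μ)) : HasIndicator W ∅ :=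
  ⟨0, W.zero_mem, by
    rw [indicator_empty]
    exact Lp.coeFn_zero ℝ 1 μ⟩

theorem union (hs : HasIndicator W s) (ht : HasIndicator W t) (h : Disjoint s t) :
    HasIndicator W (s ∪ t) := by
  obtain ⟨φ, hφ, he⟩ := hs
  obtain ⟨ψ, hψ, he'⟩ := ht
  refine ⟨φ + ψ, W.add_mem hφ hψ, ?_⟩
  filter_upwards [Lp.coeFn_add φ ψ, he, he'] with z h1 h2 h3
  rw [h1, Pi.add_apply, h2, h3, indicator_union_of_disjoint h]

theorem sdiff (hs : HasIndicator W s) (ht : HasIndicator W t) (h : t ⊆ s) :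
    HasIndicator W (s \ t) := by
  obtain ⟨φ, hφ, he⟩ := hs
  obtain ⟨ψ, hψ, he'⟩ := ht
  refine ⟨φ - ψ, W.sub_mem hφ hψ, ?_⟩
  filter_upwards [Lp.coeFn_sub φ ψ, he, he'] with z h1 h2 h3
  rw [h1, Pi.sub_apply, h2, h3, indicator_sdiff h, Pi.sub_apply]

/-- For `t ⊆ s` the `L¹` distance of the two indicators is `μ (s \ t)`. -/
theorem of_approx (hW : IsClosed (W : Set (Lp ℝ 1 μ))) (hs : MeasurableSet s) (hμs : μ s ≠ ∞)
    (h : ∀ ε : ℝ≥0∞, ε ≠ 0 → ∃ t ⊆ s, MeasurableSet t ∧ HasIndicator W t ∧ μ (s \ t) ≤ ε) :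
    HasIndicator W s := by
  refine ⟨indicatorConstLp 1 hs hμs 1, ?_, indicatorConstLp_coeFn⟩
  rw [← SetLike.mem_coe, ← hW.closure_eq, EMetric.mem_closure_iff]
  intro ε hε
  obtain ⟨δ, hδ0, hδ⟩ := exists_between hε
  obtain ⟨t, hts, htm, ⟨φ, hφ, he⟩, hle⟩ := h δ hδ0.ne'
  refine ⟨φ, hφ, lt_of_le_of_lt ?_ hδ⟩
  rw [Lp.edist_def, eLpNorm_congr_ae (g := (s \ t).indicator fun _ => (1 : ℝ)),
    eLpNorm_indicator_const (hs.diff htm) one_ne_zero ENNReal.one_ne_top]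
  · simpa using hle
  · filter_upwards [he, indicatorConstLp_coeFn (p := 1) (hs := hs) (hμs := hμs) (c := (1 : ℝ))]
      with z h1 h2
    rw [Pi.sub_apply, h1, h2, indicator_sdiff hts, Pi.sub_apply]

theorem iUnion (hW : IsClosed (W : Set (Lp ℝ 1 μ))) {s : ℕ → Set α}
    (hs : ∀ i, MeasurableSet (s i)) (hd : Pairwise (Function.onFun Disjoint s))
    (hfin : μ (⋃ i, s i) ≠ ∞) (h : ∀ i, HasIndicator W (s i)) : HasIndicator W (⋃ i, s i) := by
  refine of_approx hW (MeasurableSet.iUnion hs) hfin fun ε hε => ?_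
  have hm : ∀ n, MeasurableSet (⋃ i ∈ Finset.range n, s i) := fun n =>
    (Finset.range n).measurableSet_biUnion fun i _ => hs i
  have hi : ∀ n, HasIndicator W (⋃ i ∈ Finset.range n, s i) := by
    intro n
    induction n with
    | zero => simpa using HasIndicator.empty W
    | succ n ih =>
      rw [Finset.range_add_one, Finset.set_biUnion_insert]
      refine (h n).union ih ?_
      simp only [disjoint_iUnion_right, Finset.mem_range]
      exact fun i hi => hd hi.ne'
  have hsub : ∀ n, (⋃ i ∈ Finset.range n, s i) ⊆ ⋃ i, s i := fun n => iUnion₂_subset_iUnion _ _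
  have hmono : Monotone fun n => ⋃ i ∈ Finset.range n, s i := fun a b hab =>
    biUnion_subset_biUnion_left fun i hi => by
      simp only [Finset.mem_coe, Finset.mem_range] at hi ⊢
      omega
  have hU : ⋃ n, ⋃ i ∈ Finset.range n, s i = ⋃ i, s i := by
    refine subset_antisymm (iUnion_subset hsub) (iUnion_subset fun i => ?_)
    exact subset_iUnion_of_subset (i + 1)
      (subset_biUnion_of_mem (u := s) (by simp : i ∈ Finset.range (i + 1)))
  have ht := tendsto_measure_iUnion_atTop (μ := μ) hmono
  rw [hU] at ht
  have ht' := ENNReal.Tendsto.sub (tendsto_const_nhds (x := μ (⋃ i, s i))) ht (Or.inl hfin)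
  rw [tsub_self] at ht'
  obtain ⟨n, hn⟩ := (ht'.eventually (gt_mem_nhds (pos_iff_ne_zero.2 hε))).exists
  refine ⟨_, hsub n, hm n, hi n, ?_⟩
  rw [measure_sdiff (hsub n) (hm n).nullMeasurableSet (measure_ne_top_of_subset (hsub n) hfin)]
  exact hn.le

/-- Simple functions are combinations of such indicators and are dense in `L¹`. -/
theorem eq_top (hW : IsClosed (W : Set (Lp ℝ 1 μ)))
    (h : ∀ s, MeasurableSet s → μ s ≠ ∞ → HasIndicator W s) : W = ⊤ := by
  refine eq_top_iff.2 fun φ _ => ?_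
  refine Lp.induction ENNReal.one_ne_top (fun φ => φ ∈ W) ?_ ?_ hW φ
  · intro c s hs hμs
    obtain ⟨φ, hφ, he⟩ := h s hs hμs.ne
    have : (Lp.simpleFunc.indicatorConst 1 hs hμs.ne c : Lp ℝ 1 μ) = c • φ := by
      rw [Lp.simpleFunc.coe_indicatorConst]
      refine Lp.ext ?_
      filter_upwards [he, Lp.coeFn_smul c φ,
        indicatorConstLp_coeFn (p := 1) (hs := hs) (hμs := hμs.ne) (c := c)] with z h1 h2 h3
      rw [h2, h3, Pi.smul_apply, h1]
      by_cases hz : z ∈ s <;> simp [hz]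
    rw [this]
    exact W.smul_mem c hφ
  · exact fun f g _ _ _ hf hg => W.add_mem hf hg

end HasIndicator

end Indicator

/-! ### Density of the indicators of segments. -/

namespace RTree

variable {T : Type*} [MetricSpace T] [IsRTree T]

attribute [local instance] segMeasurableSpace

/-- A π-λ argument over the half-lines, whose preimages in `[o,x]` are empty or are again segments
from `o`. -/
theorem hasIndicator_preimage_dist {W : Submodule ℝ (Lp ℝ 1 (lengthMeasure T))}
    (hW : IsClosed (W : Set (Lp ℝ 1 (lengthMeasure T)))) {o : T}
    (h : ∀ x, HasIndicator W (seg o x)) (x : T) {C : Set ℝ} (hC : MeasurableSet C) :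
    HasIndicator W (dist o ⁻¹' C ∩ seg o x) := by
  induction C, hC using MeasurableSpace.induction_on_inter (borel_eq_generateFrom_Iic ℝ)
    isPiSystem_Iic with
  | empty => simpa using HasIndicator.empty W
  | basic C hC =>
    obtain ⟨t, rfl⟩ := hC
    rcases lt_or_ge t 0 with ht | ht
    · have : dist o ⁻¹' Iic t ∩ seg o x = ∅ :=
        eq_empty_of_forall_notMem fun z hz => (ht.trans_le dist_nonneg).not_ge hz.1
      rw [this]
      exact HasIndicator.empty W
    -- The part of `[o,x]` within distance `t` of `o` ends at distance `t`, or at `x` if `t`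
    -- overshoots.
    · have hmem : min t (dist o x) ∈ Icc (0 : ℝ) (dist o x) :=
        ⟨le_min ht dist_nonneg, min_le_right _ _⟩
      have : dist o ⁻¹' Iic t ∩ seg o x = seg o (geodExt o x (min t (dist o x))) := by
        have hg := geodExt_mem_seg o x hmem
        have hd := dist_left_geodExt o x hmem
        ext z
        constructor
        · rintro ⟨h1, h2⟩
          refine mem_seg_of_dist_le h2 hg ?_
          rw [hd]
          exact le_min h1 (dist_left_le_of_mem_seg h2)
        · intro hz
          refine ⟨(dist_left_le_of_mem_seg hz).trans ?_, mem_seg_trans hz hg⟩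
          rw [hd]
          exact min_le_left _ _
      rw [this]
      exact h _
  | compl C hC ih =>
    have : dist o ⁻¹' Cᶜ ∩ seg o x = seg o x \ (dist o ⁻¹' C ∩ seg o x) := by
      ext z
      simp only [mem_inter_iff, mem_preimage, mem_compl_iff, mem_sdiff]
      tauto
    rw [this]
    exact (h x).sdiff ih inter_subset_right
  | iUnion C hd hC ih =>
    rw [preimage_iUnion, iUnion_inter]
    refine HasIndicator.iUnion hW
      (fun i => (measurable_dist_left o (hC i)).inter (measurableSet_seg o x))
      (fun i j hij => ((hd hij).preimage _).mono inter_subset_left inter_subset_left) ?_ ih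
    exact measure_ne_top_of_subset (iUnion_subset fun i => inter_subset_right)
      (lengthMeasure_seg_ne_top o x)

/-- A closed subspace of `L¹` with the indicators of all segments `[o, x]` is everything. -/
theorem eq_top_of_hasIndicator_seg {W : Submodule ℝ (Lp ℝ 1 (lengthMeasure T))}
    (hW : IsClosed (W : Set (Lp ℝ 1 (lengthMeasure T)))) {o : T}
    (h : ∀ x, HasIndicator W (seg o x)) : W = ⊤ := by
  classical
  have hseg : ∀ A : Set T, MeasurableSet A → ∀ x, HasIndicator W (A ∩ seg o x) := by
    intro A hA x
    obtain ⟨C, hC, he⟩ := exists_ae_eq_preimage_dist hA o x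
    exact (hasIndicator_preimage_dist hW h x hC).congr he
  refine HasIndicator.eq_top hW fun A hA hfin => ?_
  have hfinset : ∀ Z : Finset T, HasIndicator W (A ∩ finsetUnion o Z) := by
    intro Z
    induction Z using Finset.induction_on with
    | empty => simpa [finsetUnion] using HasIndicator.empty W
    | insert x Z _ ih =>
      have : A ∩ finsetUnion o (insert x Z) =
          (A ∩ finsetUnion o Z) ∪ ((A \ finsetUnion o Z) ∩ seg o x) := by
        ext z
        simp only [finsetUnion, Finset.set_biUnion_insert, mem_inter_iff, mem_union, mem_sdiff]
        tauto
      rw [this]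
      refine ih.union (hseg _ (hA.diff (measurableSet_finsetUnion o Z)) x) ?_
      exact disjoint_left.2 fun z hz hz' => hz'.1.2 hz.2
  refine HasIndicator.of_approx hW hA hfin fun ε hε => ?_
  obtain ⟨Z, hZ⟩ := exists_finset_lengthMeasure_diff_le o hA hfin hε
  refine ⟨A ∩ finsetUnion o Z, inter_subset_left, hA.inter (measurableSet_finsetUnion o Z),
    hfinset Z, ?_⟩
  rwa [sdiff_self_inter]

end RTree

/-! ### Equality of norms on finite combinations. -/

namespace RTree

variable {T : Type*} [MetricSpace T] [IsRTree T]

attribute [local instance] segMeasurableSpace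

/-- The step function `∑ a(x) 1_{[o,x]}`. -/
noncomputable def segSum (o : T) (S : Finset T) (a : T → ℝ) (z : T) : ℝ :=
  ∑ x ∈ S, a x * (seg o x).indicator (fun _ => 1) z

theorem integrable_indicator_seg (x y : T) :
    Integrable ((seg x y).indicator fun _ => (1 : ℝ)) (lengthMeasure T) :=
  (integrable_indicator_iff (measurableSet_seg x y)).2
    (integrableOn_const (lengthMeasure_seg_ne_top x y))

theorem measurable_segSum (o : T) (S : Finset T) (a : T → ℝ) : Measurable (segSum o S a) :=
  Finset.measurable_fun_sum _ fun x _ =>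
    (measurable_const.indicator (measurableSet_seg o x)).const_mul _

theorem integrable_segSum (o : T) (S : Finset T) (a : T → ℝ) :
    Integrable (segSum o S a) (lengthMeasure T) :=
  integrable_finsetSum _ fun x _ => (integrable_indicator_seg o x).const_mul _

theorem lengthMeasure_real_seg (x y : T) : (lengthMeasure T).real (seg x y) = dist x y := by
  rw [Measure.real, lengthMeasure_seg, ENNReal.toReal_ofReal dist_nonneg]

/-- Values of a Lipschitz function are controlled by the `L¹` norm of the associated step
function, if the set of points is closed under branch points. -/
theorem abs_sum_le_of_branch_mem {o : T} {f : T → ℝ} {K : ℝ}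
    (hf : ∀ x y, |f y - f x| ≤ K * dist x y) (h0 : f o = 0) (n : ℕ) :
    ∀ S : Finset T, S.card = n → o ∈ S → (∀ x ∈ S, ∀ y ∈ S, branch o x y ∈ S) → ∀ a : T → ℝ,
      |∑ x ∈ S, a x * f x| ≤ K * ∫ z, |segSum o S a z| ∂lengthMeasure T := by
  classical
  induction n with
  | zero =>
    intro S hS ho
    rw [Finset.card_eq_zero] at hS
    simp [hS] at ho
  | succ n ih =>
    intro S hS ho hbr a
    -- A point of `S` farthest from the root is a leaf: it lies on `[o,y]` for no other `y ∈ S`. The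
    -- induction removes it.
    obtain ⟨x, hx, hmax⟩ := S.exists_max_image (dist o) ⟨o, ho⟩
    rcases eq_or_ne x o with rfl | hxo
    · have hS1 : S = {x} := Finset.eq_singleton_iff_unique_mem.2 ⟨ho, fun y hy => by
        have := hmax y hy
        rw [dist_self] at this
        exact (dist_le_zero.1 this).symm⟩
      have : ∀ z, segSum x S a z = a x * ({x} : Set T).indicator (fun _ => 1) z := fun z => by
        simp [segSum, hS1]
      simp only [this, abs_mul]
      rw [integral_const_mul]
      have hz : (fun z => |({x} : Set T).indicator (fun _ => (1 : ℝ)) z|) =ᵐ[lengthMeasure T] 0 := by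
        have : ({x} : Set T)ᶜ ∈ ae (lengthMeasure T) :=
          compl_mem_ae_iff.2 (measure_singleton x)
        filter_upwards [this] with z hz
        rw [indicator_of_notMem hz]
        simp
      rw [integral_congr_ae hz]
      simp [hS1, h0]
    -- `p` is the parent of `x`. Removing `x` and adding its coefficient to that of `p` changes the
    -- step function only on the edge `[o,x] \ [o,p]`.
    · obtain ⟨p, hp, hpmax⟩ := ((S.erase x).filter (· ∈ seg o x)).exists_max_image (dist o)
        ⟨o, by simp [ho, hxo.symm, left_mem_seg]⟩
      rw [Finset.mem_filter] at hp
      obtain ⟨hpS, hpx⟩ := hp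
      set S' := S.erase x with hS'
      set a' : T → ℝ := a + Pi.single p (a x) with ha'
      have hne : ∀ y ∈ S', x ∉ seg o y := by
        intro y hy hxy
        have h1 := dist_left_le_of_mem_seg hxy
        have h2 := hmax y (Finset.mem_of_mem_erase hy)
        have h3 := dist_of_mem_seg hxy (right_mem_seg o y)
        rw [le_antisymm h1 h2, sub_self, abs_zero, dist_eq_zero] at h3
        exact Finset.ne_of_mem_erase hy h3.symm
      have hbr' : ∀ y ∈ S', ∀ z ∈ S', branch o y z ∈ S' := fun y hy z hz =>
        Finset.mem_erase.2 ⟨fun h => hne y hy (h ▸ branch_mem_left o y z),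
          hbr y (Finset.mem_of_mem_erase hy) z (Finset.mem_of_mem_erase hz)⟩
      have hcard : S'.card = n := by rw [hS', Finset.card_erase_of_mem hx, hS]; rfl
      have hsum : ∀ g : T → ℝ, ∑ y ∈ S', a' y * g y = ∑ y ∈ S', a y * g y + a x * g p := by
        intro g
        simp only [ha', Pi.add_apply, add_mul, Finset.sum_add_distrib]
        congr 1
        rw [Finset.sum_eq_single_of_mem p hpS fun y _ hy => by simp [Pi.single_eq_of_ne hy]]
        simp
      have hsum' : ∀ g : T → ℝ,
          ∑ y ∈ S, a y * g y = ∑ y ∈ S', a' y * g y + a x * (g x - g p) := by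
        intro g
        rw [hsum, ← Finset.add_sum_erase S _ hx]
        ring
      set D := seg o x \ seg o p with hD
      have hDm : MeasurableSet D := (measurableSet_seg o x).diff (measurableSet_seg o p)
      have hDi : ∀ z, D.indicator (fun _ => (1 : ℝ)) z =
          (seg o x).indicator (fun _ => 1) z - (seg o p).indicator (fun _ => 1) z := by
        intro z
        rw [hD, indicator_sdiff (seg_subset_seg hpx), Pi.sub_apply]
      -- If `z ∈ [o,y]` with `y` remaining, then `z` precedes the branch point of `x` and `y`. That
      -- point is in `S'` and on `[o,x]`, so by the choice of `p` it precedes `p`, forcing `z ∈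
      -- [o,p]`.
      have hzero : ∀ z ∈ D, segSum o S' a' z = 0 := by
        intro z hz
        refine Finset.sum_eq_zero fun y hy => ?_
        rw [indicator_of_notMem, mul_zero]
        intro hzy
        have hm : branch o x y ∈ S' := Finset.mem_erase.2
          ⟨fun h => hne y hy (h ▸ branch_mem_right o x y), hbr x hx y (Finset.mem_of_mem_erase hy)⟩
        have hle := hpmax _ (Finset.mem_filter.2 ⟨hm, branch_mem_left o x y⟩)
        exact hz.2 (mem_seg_trans (mem_seg_branch hz.1 hzy)
          (mem_seg_of_dist_le (branch_mem_left o x y) hpx hle))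
      -- The two terms have disjoint supports, so the absolute values add.
      have habs : ∀ z, |segSum o S a z| =
          |segSum o S' a' z| + |a x| * D.indicator (fun _ => 1) z := by
        intro z
        rw [segSum, hsum' fun y => (seg o y).indicator (fun _ => 1) z, ← hDi, ← segSum]
        by_cases hz : z ∈ D
        · simp [hzero z hz, hz]
        · simp [hz]
      have hDint : Integrable (D.indicator fun _ => (1 : ℝ)) (lengthMeasure T) := by
        refine (integrable_indicator_iff hDm).2 (integrableOn_const ?_)
        exact measure_ne_top_of_subset sdiff_subset (lengthMeasure_seg_ne_top o x)
      have hDr : (lengthMeasure T).real D = dist p x := by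
        rw [measureReal_sdiff (seg_subset_seg hpx) (measurableSet_seg o p)
          (lengthMeasure_seg_ne_top o x), lengthMeasure_real_seg, lengthMeasure_real_seg]
        linarith [mem_seg_iff.1 hpx]
      rw [hsum' f]
      simp only [habs]
      rw [integral_add (integrable_segSum o S' a').abs (hDint.const_mul _), integral_const_mul,
        integral_indicator_const _ hDm, hDr, smul_eq_mul, mul_one, mul_add]
      refine (abs_add_le _ _).trans (add_le_add (ih S' hcard ?_ hbr' a') ?_)
      · exact Finset.mem_erase.2 ⟨hxo.symm, ho⟩
      · rw [abs_mul]
        have := mul_le_mul_of_nonneg_left (hf p x) (abs_nonneg (a x))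
        linarith

theorem abs_sum_le {o : T} {f : T → ℝ} {K : ℝ} (hf : ∀ x y, |f y - f x| ≤ K * dist x y)
    (h0 : f o = 0) (a : T →₀ ℝ) : |∑ x ∈ a.support, a x * f x| ≤
      K * ∫ z, |segSum o a.support a z| ∂lengthMeasure T := by
  obtain ⟨S, hS, ho, hbr⟩ := exists_finset_branch_mem o a.support
  have hsum : ∀ g : T → ℝ, ∑ x ∈ a.support, a x * g x = ∑ x ∈ S, a x * g x := fun g =>
    Finset.sum_subset hS fun x _ hx => by rw [Finsupp.notMem_support_iff.1 hx, zero_mul]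
  have := abs_sum_le_of_branch_mem hf h0 _ S rfl ho hbr a
  rw [hsum]
  simp only [segSum] at this ⊢
  simp only [fun z => hsum fun x => (seg o x).indicator (fun _ => 1) z]
  exact this

/-- By `seg_subset_union` the symmetric difference of `[o,x]` and `[o,y]` lies in `[x,y]`, which has
length `dist x y`. -/
theorem abs_setIntegral_sub_le (o x y : T) {g : T → ℝ} (hg : Measurable g) (h1 : ∀ z, |g z| ≤ 1) :
    |∫ z in seg o y, g z ∂lengthMeasure T - ∫ z in seg o x, g z ∂lengthMeasure T| ≤ dist x y := by
  have hint : ∀ x, Integrable ((seg o x).indicator g) (lengthMeasure T) := fun x =>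
    (integrable_indicator_seg o x).mono' (hg.indicator (measurableSet_seg o x)).aestronglyMeasurable
      (Filter.Eventually.of_forall fun z => by
        by_cases hz : z ∈ seg o x <;> simp [hz, h1])
  rw [← integral_indicator (measurableSet_seg o y), ← integral_indicator (measurableSet_seg o x),
    ← integral_sub (hint y) (hint x), ← lengthMeasure_real_seg, ← Real.norm_eq_abs]
  refine (norm_integral_le_of_norm_le (integrable_indicator_seg x y)
    (Filter.Eventually.of_forall fun z => ?_)).trans_eq ?_
  · have hxy := @seg_subset_union T _ _ o x y z
    have hyx := @seg_subset_union T _ _ o y x z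
    rw [seg_comm y x] at hyx
    have := h1 z
    by_cases hx : z ∈ seg o x <;> by_cases hy : z ∈ seg o y <;> by_cases hz : z ∈ seg x y <;>
      simp_all
  · rw [integral_indicator_const _ (measurableSet_seg x y), smul_eq_mul, mul_one]

/-- The function on `T` with derivative `g` away from the root. -/
noncomputable def primitive (o : T) {g : T → ℝ} (hg : Measurable g) (h1 : ∀ z, |g z| ≤ 1) :
    Lip0 o :=
  ⟨fun x => ∫ z in seg o x, g z ∂lengthMeasure T, by
    refine setIntegral_measure_zero _ ?_
    rw [seg_self]
    exact measure_singleton o, 1, LipschitzWith.of_dist_le_mul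
      fun x y => by
        rw [NNReal.coe_one, one_mul, dist_comm, dist_comm x, Real.dist_eq, dist_comm]
        exact abs_setIntegral_sub_le o x y hg h1⟩

theorem norm_primitive_le (o : T) {g : T → ℝ} (hg : Measurable g) (h1 : ∀ z, |g z| ≤ 1) :
    ‖primitive o hg h1‖ ≤ 1 :=
  Lip0.norm_le_of _ zero_le_one fun x y => by
    rw [one_mul]
    exact abs_setIntegral_sub_le o x y hg h1

/-- Take for `F` the primitive of the sign of the step function `h`: interchanging sum and integral
leaves `∫ h · sign h`. -/
theorem exists_lip0_sum_eq (o : T) (a : T →₀ ℝ) : ∃ F : Lip0 o, ‖F‖ ≤ 1 ∧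
    ∑ x ∈ a.support, a x * F x = ∫ z, |segSum o a.support a z| ∂lengthMeasure T := by
  set h := segSum o a.support a with hh
  have hm : Measurable h := measurable_segSum _ _ _
  have hg : Measurable fun z => if 0 ≤ h z then (1 : ℝ) else -1 :=
    Measurable.ite (measurableSet_le measurable_const hm) measurable_const measurable_const
  have h1 : ∀ z, |if 0 ≤ h z then (1 : ℝ) else -1| ≤ 1 := fun z => by split_ifs <;> simp
  refine ⟨primitive o hg h1, norm_primitive_le o hg h1, ?_⟩
  have hint : ∀ x, Integrable ((seg o x).indicator fun z => if 0 ≤ h z then (1 : ℝ) else -1)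
      (lengthMeasure T) := fun x =>
    (integrable_indicator_seg o x).mono' (hg.indicator (measurableSet_seg o x)).aestronglyMeasurable
      (Filter.Eventually.of_forall fun z => by
        by_cases hz : z ∈ seg o x
        · simpa [hz] using h1 z
        · simp [hz])
  have : ∀ x, (primitive o hg h1) x =
      ∫ z, (seg o x).indicator (fun z => if 0 ≤ h z then (1 : ℝ) else -1) z ∂lengthMeasure T :=
    fun x => (integral_indicator (measurableSet_seg o x)).symm
  simp only [this, ← integral_const_mul]
  rw [← integral_finsetSum _ fun x _ => (hint x).const_mul _]
  refine integral_congr_ae (Filter.Eventually.of_forall fun z => ?_)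
  have habs : |h z| = h z * if 0 ≤ h z then (1 : ℝ) else -1 := by
    split_ifs with h0
    · rw [abs_of_nonneg h0, mul_one]
    · rw [abs_of_neg (not_le.1 h0), mul_neg_one]
  simp only
  rw [habs]
  refine Eq.trans ?_ (Finset.sum_mul _ _ _).symm
  refine Finset.sum_congr rfl fun x _ => ?_
  by_cases hz : z ∈ seg o x <;> simp [hz]

/-- The indicator of `[o, x]` as an element of `L¹`. -/
noncomputable def segLp (o x : T) : Lp ℝ 1 (lengthMeasure T) :=
  indicatorConstLp 1 (measurableSet_seg o x) (lengthMeasure_seg_ne_top o x) 1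

theorem coeFn_linearCombination_segLp (o : T) (a : T →₀ ℝ) :
    (Finsupp.linearCombination ℝ (segLp o) a : T → ℝ) =ᵐ[lengthMeasure T]
      segSum o a.support a := by
  have h : ∀ S : Finset T, ((∑ x ∈ S, a x • segLp o x : Lp ℝ 1 (lengthMeasure T)) : T → ℝ)
      =ᵐ[lengthMeasure T] segSum o S a := by
    classical
    intro S
    induction S using Finset.induction_on with
    | empty =>
      filter_upwards [Lp.coeFn_zero ℝ 1 (lengthMeasure T)] with z hz
      rw [Finset.sum_empty, hz]
      rfl
    | insert x S hx ih =>
      rw [Finset.sum_insert hx]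
      filter_upwards [Lp.coeFn_add (a x • segLp o x) (∑ x ∈ S, a x • segLp o x),
        Lp.coeFn_smul (a x) (segLp o x), ih, indicatorConstLp_coeFn (p := 1)
          (hs := measurableSet_seg o x) (hμs := lengthMeasure_seg_ne_top o x) (c := (1 : ℝ))]
        with z h1 h2 h3 h4
      rw [h1, Pi.add_apply, h2, h3, Pi.smul_apply, segLp, h4, segSum, segSum,
        Finset.sum_insert hx, smul_eq_mul]
  exact h a.support

theorem norm_linearCombination_segLp (o : T) (a : T →₀ ℝ) :
    ‖Finsupp.linearCombination ℝ (segLp o) a‖ =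
      ∫ z, |segSum o a.support a z| ∂lengthMeasure T := by
  rw [L1.norm_eq_integral_norm]
  refine integral_congr_ae ?_
  filter_upwards [coeFn_linearCombination_segLp o a] with z hz
  rw [hz, Real.norm_eq_abs]

theorem linearCombination_eval_apply {M : Type*} [MetricSpace M] (o : M) (a : M →₀ ℝ) (f : Lip0 o) :
    Finsupp.linearCombination ℝ (Lip0.eval o) a f = ∑ x ∈ a.support, a x * f x := by
  rw [Finsupp.linearCombination_apply, Finsupp.sum, sum_apply]
  rfl

theorem norm_linearCombination_eval (o : T) (a : T →₀ ℝ) :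
    ‖Finsupp.linearCombination ℝ (Lip0.eval o) a‖ =
      ‖Finsupp.linearCombination ℝ (segLp o) a‖ := by
  refine le_antisymm ?_ ?_
  · refine ContinuousLinearMap.opNorm_le_bound _ (norm_nonneg _) fun f => ?_
    rw [linearCombination_eval_apply, norm_linearCombination_segLp, Real.norm_eq_abs, mul_comm]
    exact abs_sum_le (Lip0.abs_sub_le f) (Lip0.apply_origin f) a
  · obtain ⟨F, hF, he⟩ := exists_lip0_sum_eq o a
    rw [norm_linearCombination_segLp, ← he, ← linearCombination_eval_apply]
    refine (le_abs_self _).trans ?_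
    rw [← Real.norm_eq_abs]
    exact ContinuousLinearMap.le_of_opNorm_le_of_le _ le_rfl hF |>.trans_eq (mul_one _)

theorem denseRange_linearCombination_segLp (o : T) :
    DenseRange (Finsupp.linearCombination ℝ (segLp o)) := by
  have h : (LinearMap.range (Finsupp.linearCombination ℝ (segLp o))).topologicalClosure = ⊤ := by
    refine eq_top_of_hasIndicator_seg (Submodule.isClosed_topologicalClosure _) (o := o)
      fun x => ⟨segLp o x, ?_, indicatorConstLp_coeFn⟩
    refine Submodule.le_topologicalClosure _ ⟨Finsupp.single x 1, ?_⟩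
    simp
  rw [← Submodule.dense_iff_topologicalClosure_eq_top] at h
  exact h

end RTree

/-! ### The isometry onto `L¹` of the length measure. -/

/-- The evaluation functional as an element of the Lipschitz-free space. -/
noncomputable def LipFree.delta {M : Type*} [MetricSpace M] (o x : M) : LipFree o :=
  ⟨Lip0.eval o x, Submodule.le_topologicalClosure _ (Submodule.subset_span (mem_range_self x))⟩

theorem LipFree.coe_linearCombination_delta {M : Type*} [MetricSpace M] (o : M) (a : M →₀ ℝ) :
    (Finsupp.linearCombination ℝ (LipFree.delta o) a : StrongDual ℝ (Lip0 o)) =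
      Finsupp.linearCombination ℝ (Lip0.eval o) a :=
  Finsupp.apply_linearCombination ℝ (LipFree o).subtype (LipFree.delta o) a

theorem LipFree.denseRange_linearCombination_delta {M : Type*} [MetricSpace M] (o : M) :
    DenseRange (Finsupp.linearCombination ℝ (LipFree.delta o)) := by
  rw [DenseRange, Subtype.dense_iff]
  intro v hv
  refine closure_mono ?_ hv
  intro w hw
  rw [SetLike.mem_coe, ← Finsupp.range_linearCombination] at hw
  obtain ⟨a, rfl⟩ := hw
  exact ⟨_, mem_range_self a, LipFree.coe_linearCombination_delta o a⟩

instance LipFree.completeSpace {M : Type*} [MetricSpace M] (o : M) : CompleteSpace (LipFree o) :=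
  (Submodule.isClosed_topologicalClosure _).completeSpace_coe

/-- The Lipschitz-free space of an ℝ-tree is isometric to `L¹` of the length measure. -/
noncomputable def RTree.lipFreeEquiv {T : Type*} [MetricSpace T] [IsRTree T] (o : T) :
    LipFree o ≃ₗᵢ[ℝ] Lp ℝ 1 (RTree.lengthMeasure T) :=
  -- Neither map is injective, as both kill the origin; equality of norms makes the correspondence
  -- well defined, and density with completeness extends it.
  LinearEquiv.extendOfIsometry (LinearEquiv.refl ℝ (T →₀ ℝ))
    (Finsupp.linearCombination ℝ (LipFree.delta o)) (Finsupp.linearCombination ℝ (RTree.segLp o))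
    (LipFree.denseRange_linearCombination_delta o) (RTree.denseRange_linearCombination_segLp o)
    fun a => by
      rw [← Submodule.norm_coe (s := LipFree o), LipFree.coe_linearCombination_delta,
        RTree.norm_linearCombination_eval, LinearEquiv.refl_apply]

/-! ### Distribution functions of measures without atoms. -/

section DistributionFunction

open ProbabilityTheory Filter Topology

variable (m : Measure ℝ) [IsProbabilityMeasure m] [NullSingletonClass m]

/-- A jump of the distribution function is the mass of an atom. -/
theorem continuous_cdf : Continuous (cdf m) := by
  refine continuous_iff_continuousAt.2 fun x => ?_
  have h := (cdf m).measure_singleton x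
  rw [measure_cdf, measure_singleton, eq_comm, ENNReal.ofReal_eq_zero] at h
  rw [(monotone_cdf m).continuousAt_iff_leftLim_eq_rightLim, (cdf m).rightLim_eq]
  exact le_antisymm ((monotone_cdf m).leftLim_le le_rfl) (by linarith)

/-- The sublevel set is a closed ray `(-∞, s]`. By the intermediate value theorem `t` is attained,
hence also at `s`, and the mass of the ray is the value there. -/
theorem measure_cdf_le_of_mem_Ioo {t : ℝ} (ht : t ∈ Ioo (0 : ℝ) 1) :
    m (cdf m ⁻¹' Iic t) = ENNReal.ofReal t := by
  have hcl : IsClosed (cdf m ⁻¹' Iic t) := isClosed_Iic.preimage (continuous_cdf m)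
  obtain ⟨b, hb⟩ := ((tendsto_cdf_atTop m).eventually (lt_mem_nhds ht.2)).exists
  obtain ⟨a, ha⟩ := ((tendsto_cdf_atBot m).eventually (gt_mem_nhds ht.1)).exists
  have hbdd : BddAbove (cdf m ⁻¹' Iic t) :=
    ⟨b, fun y hy => le_of_not_gt fun hby => (hb.trans_le (monotone_cdf m hby.le)).not_ge hy⟩
  obtain ⟨s, -, hs⟩ := intermediate_value_Icc
    (le_of_not_gt fun hba => (ha.trans hb).not_ge (monotone_cdf m hba.le))
    (continuous_cdf m).continuousOn (show t ∈ Icc (cdf m a) (cdf m b) from ⟨ha.le, hb.le⟩)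
  have hs' : s ∈ cdf m ⁻¹' Iic t := hs.le
  have hmem := hcl.csSup_mem ⟨s, hs'⟩ hbdd
  have heq : cdf m ⁻¹' Iic t = Iic (sSup (cdf m ⁻¹' Iic t)) := by
    ext y
    exact ⟨fun hy => le_csSup hbdd hy, fun hy => (monotone_cdf m hy).trans hmem⟩
  rw [heq, ← ofReal_cdf]
  congr 1
  exact le_antisymm hmem (hs.symm.le.trans (monotone_cdf m (le_csSup hbdd hs')))

/-- The distribution function of a measure without atoms is uniformly distributed. -/
theorem measurePreserving_cdf :
    MeasurePreserving (cdf m) m ((volume : Measure ℝ).restrict (Icc 0 1)) := by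
  have hmeas : Measurable (cdf m) := (continuous_cdf m).measurable
  refine ⟨hmeas, ?_⟩
  have : IsProbabilityMeasure (m.map (cdf m)) := Measure.isProbabilityMeasure_map hmeas.aemeasurable
  refine Measure.ext_of_Iic _ _ fun t => ?_
  rw [Measure.map_apply hmeas measurableSet_Iic, Measure.restrict_apply measurableSet_Iic]
  -- The value `0` need not be attained, so this case is squeezed from small positive levels; the
  -- bound `1/2` keeps them below `1`.
  have h0 : m (cdf m ⁻¹' Iic 0) = 0 := by
    refine le_antisymm (le_of_forall_gt fun c hc => ?_) zero_le
    obtain ⟨δ, hδ0, hδ⟩ := ENNReal.lt_iff_exists_nnreal_btwn.1 hc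
    have hδ0' : (0 : ℝ) < δ := by exact_mod_cast hδ0
    have hmin : min (δ : ℝ) (1 / 2) ∈ Ioo (0 : ℝ) 1 :=
      ⟨lt_min hδ0' (by norm_num), (min_le_right _ _).trans_lt (by norm_num)⟩
    calc m (cdf m ⁻¹' Iic 0) ≤ m (cdf m ⁻¹' Iic (min (δ : ℝ) (1 / 2))) :=
          measure_mono (preimage_mono (Iic_subset_Iic.2 hmin.1.le))
      _ = ENNReal.ofReal (min (δ : ℝ) (1 / 2)) := measure_cdf_le_of_mem_Ioo m hmin
      _ ≤ ENNReal.ofReal δ := ENNReal.ofReal_le_ofReal (min_le_left _ _)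
      _ < c := by rwa [ENNReal.ofReal_coe_nnreal]
  rcases lt_or_ge 0 t with h | h
  · rcases lt_or_ge t 1 with h1 | h1
    · have : Iic t ∩ Icc 0 1 = Icc 0 t := by
        ext y
        simp only [mem_inter_iff, mem_Iic, mem_Icc]
        exact ⟨fun hy => ⟨hy.2.1, hy.1⟩, fun hy => ⟨hy.2, hy.1, hy.2.trans h1.le⟩⟩
      rw [measure_cdf_le_of_mem_Ioo m ⟨h, h1⟩, this, Real.volume_Icc, sub_zero]
    · have h2 : cdf m ⁻¹' Iic t = univ := eq_univ_of_forall fun y => (cdf_le_one m y).trans h1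
      rw [h2, measure_univ, inter_eq_right.2 fun y hy => hy.2.trans h1, Real.volume_Icc]
      simp
  · have h2 : Iic t ∩ Icc (0 : ℝ) 1 ⊆ {0} := fun y hy => le_antisymm (hy.1.trans h) hy.2.1
    rw [measure_mono_null h2 Real.volume_singleton]
    exact measure_mono_null (preimage_mono (Iic_subset_Iic.2 h)) h0

/-- The distribution function need not be injective, but it is constant only on null sets: `(-∞, t]`
and the set where `cdf m ≤ cdf m t` have the same mass. Complements and countable unions follow. -/
theorem exists_ae_eq_preimage_cdf {C : Set ℝ} (hC : MeasurableSet C) :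
    ∃ C' : Set ℝ, MeasurableSet C' ∧ C =ᵐ[m] cdf m ⁻¹' C' := by
  rw [borel_eq_generateFrom_Iic ℝ |> (BorelSpace.measurable_eq (α := ℝ)).trans] at hC
  induction C, hC using MeasurableSpace.generateFrom_induction with
  | hC C hC =>
    obtain ⟨t, rfl⟩ := hC
    refine ⟨Iic (cdf m t), measurableSet_Iic, ?_⟩
    have hsub : Iic t ⊆ cdf m ⁻¹' Iic (cdf m t) := fun y hy => monotone_cdf m hy
    refine ae_eq_of_subset_of_measure_ge hsub ?_ measurableSet_Iic.nullMeasurableSet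
      (measure_ne_top _ _)
    rw [(measurePreserving_cdf m).measure_preimage measurableSet_Iic.nullMeasurableSet,
      Measure.restrict_apply measurableSet_Iic, ← ofReal_cdf]
    refine (measure_mono (t := Icc 0 (cdf m t)) fun y hy => ⟨hy.2.1, hy.1⟩).trans_eq ?_
    rw [Real.volume_Icc, sub_zero]
  | empty => exact ⟨∅, MeasurableSet.empty, by simp⟩
  | compl C _ ih =>
    obtain ⟨C', h1, h2⟩ := ih
    exact ⟨C'ᶜ, h1.compl, h2.compl⟩
  | iUnion C _ ih =>
    choose C' h1 h2 using ih
    refine ⟨⋃ i, C' i, MeasurableSet.iUnion h1, ?_⟩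
    rw [preimage_iUnion]
    exact Filter.EventuallyEq.countable_iUnion h2

end DistributionFunction

/-! ### Isometries between `L¹` spaces. -/

section Isometries

variable {α β : Type*} {mα : MeasurableSpace α} {mβ : MeasurableSpace β}

/-- The range of an isometry of a complete space is closed, and this one contains the indicators. -/
theorem surjective_compMeasurePreserving {ν : Measure α} {ρ : Measure β} [IsFiniteMeasure ρ]
    {θ : α → β} (hθ : MeasurePreserving θ ν ρ)
    (h : ∀ A, MeasurableSet A → ∃ C, MeasurableSet C ∧ A =ᵐ[ν] θ ⁻¹' C) :
    Function.Surjective (Lp.compMeasurePreservingₗᵢ (E := ℝ) (p := 1) ℝ θ hθ) := by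
  have hcl : IsClosed (LinearMap.range
      (Lp.compMeasurePreservingₗᵢ (E := ℝ) (p := 1) ℝ θ hθ).toLinearMap : Set (Lp ℝ 1 ν)) :=
    (Lp.compMeasurePreservingₗᵢ (E := ℝ) (p := 1) ℝ θ hθ).isometry.isClosedEmbedding.isClosed_range
  refine LinearMap.range_eq_top.1 (HasIndicator.eq_top hcl fun A hA _ => ?_)
  obtain ⟨C, hC, he⟩ := h A hA
  refine HasIndicator.congr ⟨_, ⟨indicatorConstLp 1 hC (measure_ne_top ρ C) 1, rfl⟩, ?_⟩ he
  refine (Lp.coeFn_compMeasurePreserving _ hθ).trans ?_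
  exact hθ.quasiMeasurePreserving.ae_eq_comp indicatorConstLp_coeFn

theorem surjective_withDensitySMulLI (μ : Measure α) {g : α → ℝ≥0} (hg : Measurable g)
    (hpos : ∀ x, 0 < g x) : Function.Surjective (withDensitySMulLI (E := ℝ) μ hg) := by
  intro φ
  have hsmul : ∀ x, g x • ((g x)⁻¹ • φ x) = φ x := fun x => smul_inv_smul₀ (hpos x).ne' _
  have hint : Integrable (fun x => (g x)⁻¹ • φ x) (μ.withDensity fun x => g x) := by
    rw [integrable_withDensity_iff_integrable_smul hg]
    simp only [hsmul]
    exact L1.integrable_coeFn φ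
  refine ⟨(memLp_one_iff_integrable.2 hint).toLp _, ?_⟩
  rw [withDensitySMulLI_apply]
  refine Lp.ext ((MemLp.coeFn_toLp _).trans ?_)
  have h := (ae_withDensity_iff hg.coe_nnreal_ennreal).1
    (memLp_one_iff_integrable.2 hint).coeFn_toLp
  filter_upwards [h] with x hx
  rw [hx (ENNReal.coe_ne_zero.2 (hpos x).ne'), hsmul]

/-- Normalise a positive function of finite integral, which exists by σ-finiteness; its integral is
nonzero since `μ ≠ 0`. -/
theorem exists_isProbabilityMeasure_withDensity (μ : Measure α) [SigmaFinite μ] (h0 : μ ≠ 0) :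
    ∃ g : α → ℝ≥0, Measurable g ∧ (∀ x, 0 < g x) ∧
      IsProbabilityMeasure (μ.withDensity fun x => g x) := by
  obtain ⟨g, hpos, hg, hlt⟩ := exists_pos_lintegral_lt_of_sigmaFinite μ one_ne_zero
  set c := ∫⁻ x, g x ∂μ with hc
  have hc0 : c ≠ 0 := by
    rw [hc, Ne, lintegral_eq_zero_iff hg.coe_nnreal_ennreal]
    intro h
    refine h0 (ae_eq_bot.1 (Filter.eventually_false_iff_eq_bot.1 ?_))
    filter_upwards [h] with x hx
    exact (hpos x).ne' (by simpa using hx)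
  have hct : c ≠ ∞ := hlt.ne_top
  have hcp : 0 < c.toNNReal := ENNReal.toNNReal_pos hc0 hct
  refine ⟨fun x => c.toNNReal⁻¹ * g x, hg.const_mul _, fun x => by have := hpos x; positivity, ⟨?_⟩⟩
  rw [withDensity_apply _ MeasurableSet.univ, Measure.restrict_univ]
  simp only [ENNReal.coe_mul]
  rw [lintegral_const_mul _ hg.coe_nnreal_ennreal, ← hc, ENNReal.coe_inv hcp.ne',
    ENNReal.coe_toNNReal hct, ENNReal.inv_mul_cancel hc0 hct]

/-- A probability measure whose `σ`-algebra comes, up to null sets, from a real function without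
atoms has the same `L¹` as the unit interval. -/
theorem nonempty_unitInterval_equiv_Lp_one (ν : Measure α) [IsProbabilityMeasure ν]
    {r : α → ℝ} (hr : Measurable r) (hat : ∀ t, ν (r ⁻¹' {t}) = 0)
    (h : ∀ A, MeasurableSet A → ∃ C, MeasurableSet C ∧ A =ᵐ[ν] r ⁻¹' C) :
    Nonempty (Lp ℝ 1 ((volume : Measure ℝ).restrict (Icc 0 1)) ≃ₗᵢ[ℝ] Lp ℝ 1 ν) := by
  have hp : IsProbabilityMeasure (ν.map r) := Measure.isProbabilityMeasure_map hr.aemeasurable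
  have hn : NullSingletonClass (ν.map r) := ⟨fun t => by
    rw [Measure.map_apply hr (measurableSet_singleton t)]
    exact hat t⟩
  have hrp : MeasurePreserving r ν (ν.map r) := ⟨hr, rfl⟩
  have hθ := (measurePreserving_cdf (ν.map r)).comp hrp
  exact ⟨LinearIsometryEquiv.ofSurjective _ (surjective_compMeasurePreserving hθ fun A hA => by
    obtain ⟨C, hC, he⟩ := h A hA
    obtain ⟨C', hC', he'⟩ := exists_ae_eq_preimage_cdf (ν.map r) hC
    exact ⟨C', hC', he.trans (hrp.quasiMeasurePreserving.preimage_ae_eq he')⟩)⟩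

/-- A `σ`-finite measure whose `σ`-algebra comes, up to null sets, from a real function without
atoms has the same `L¹` as the unit interval. -/
theorem nonempty_Lp_one_equiv_unitInterval (μ : Measure α) [SigmaFinite μ] (h0 : μ ≠ 0)
    {r : α → ℝ} (hr : Measurable r) (hat : ∀ t, μ (r ⁻¹' {t}) = 0)
    (h : ∀ A, MeasurableSet A → ∃ C, MeasurableSet C ∧ A =ᵐ[μ] r ⁻¹' C) :
    Nonempty (Lp ℝ 1 μ ≃ₗᵢ[ℝ] Lp ℝ 1 ((volume : Measure ℝ).restrict (Icc 0 1))) := by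
  obtain ⟨g, hg, hpos, hν⟩ := exists_isProbabilityMeasure_withDensity μ h0
  have hac : μ.withDensity (fun x => (g x : ℝ≥0∞)) ≪ μ := withDensity_absolutelyContinuous _ _
  obtain ⟨e⟩ := nonempty_unitInterval_equiv_Lp_one _ hr (fun t => hac (hat t)) fun A hA => by
    obtain ⟨C, hC, he⟩ := h A hA
    exact ⟨C, hC, hac.ae_eq he⟩
  exact ⟨(e.trans
    (LinearIsometryEquiv.ofSurjective _ (surjective_withDensitySMulLI μ hg hpos))).symm⟩

end Isometries

/-! ### Separable trees. -/

namespace RTree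

variable {T : Type*} [MetricSpace T] [IsRTree T]

attribute [local instance] segMeasurableSpace

variable [TopologicalSpace.SeparableSpace T] (o : T)

/-- A dense sequence of segments `[o, x]`, preceded by the complement of their union. -/
def spanningSeg (o : T) (n : ℕ) : Set T :=
  letI : Nonempty T := ⟨o⟩
  n.casesOn (⋃ k, seg o (TopologicalSpace.denseSeq T k))ᶜ
    fun k => seg o (TopologicalSpace.denseSeq T k)

theorem measurableSet_spanningSeg (n : ℕ) : MeasurableSet (spanningSeg o n) := by
  cases n with
  | zero => exact (MeasurableSet.iUnion fun k => measurableSet_seg o _).compl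
  | succ n => exact measurableSet_seg o _

theorem exists_mem_spanningSeg (z : T) : ∃ n, z ∈ spanningSeg o n := by
  by_cases h : z ∈ spanningSeg o 0
  · exact ⟨0, h⟩
  · obtain ⟨k, hk⟩ := mem_iUnion.1 (not_not.1 h)
    exact ⟨k + 1, hk⟩

/-- If `z ≠ x`, some point `w` of the dense sequence is closer to `x` than `z` is. Then `z ∉ [x,w]`,
so `z ∈ [o,w]`, which is covered. -/
theorem eq_of_mem_spanningSeg_zero {x z : T} (hz : z ∈ spanningSeg o 0) (hx : z ∈ seg o x) :
    z = x := by
  let _ : Nonempty T := ⟨o⟩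
  by_contra hne
  obtain ⟨k, hk⟩ := (TopologicalSpace.denseRange_denseSeq T).exists_dist_lt x (dist_pos.2 hne)
  rcases seg_subset_union o x (TopologicalSpace.denseSeq T k) hx with h | h
  · exact hz (mem_iUnion.2 ⟨k, h⟩)
  · have := dist_left_le_of_mem_seg h
    rw [dist_comm x z] at this
    exact hk.not_ge this

/-- Since `[x,y] ⊆ [o,x] ∪ [o,y]`, the uncovered set meets `[x,y]` at most in its endpoints. -/
theorem lengthMeasure_spanningSeg_zero : lengthMeasure T (spanningSeg o 0) = 0 := by
  refine lengthMeasure_eq_zero (measurableSet_spanningSeg o 0) fun x y => ?_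
  refine (Set.toFinite ({x, y} : Set T)).countable.mono ?_
  rintro z ⟨hz, hxy⟩
  have h := seg_subset_union x y o hxy
  rw [seg_comm x o, seg_comm y o] at h
  exact h.imp (eq_of_mem_spanningSeg_zero o hz) (eq_of_mem_spanningSeg_zero o hz)

theorem sigmaFinite_lengthMeasure : SigmaFinite (lengthMeasure T) := by
  rcases isEmpty_or_nonempty T with h | ⟨⟨o⟩⟩
  · rw [Measure.eq_zero_of_isEmpty (lengthMeasure T)]
    infer_instance
  refine ⟨⟨⟨spanningSeg o, fun _ => mem_univ _, fun n => ?_,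
    iUnion_eq_univ_iff.2 (exists_mem_spanningSeg o)⟩⟩⟩
  cases n with
  | zero => rw [lengthMeasure_spanningSeg_zero]; exact ENNReal.zero_lt_top
  | succ n => exact (lengthMeasure_seg_ne_top o _).lt_top

theorem lengthMeasure_ne_zero (S : Type*) [MetricSpace S] [IsRTree S] [Nontrivial S] :
    lengthMeasure S ≠ 0 := by
  obtain ⟨x, y, hxy⟩ := exists_pair_ne S
  intro h
  have := lengthMeasure_seg x y
  rw [h, Measure.coe_zero, Pi.zero_apply, eq_comm, ENNReal.ofReal_eq_zero] at this
  exact (dist_pos.2 hxy).not_ge this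

open Classical in
/-- The first member of the sequence `spanningSeg` that contains a point, and the distance of the
point from the root. -/
noncomputable def segCoord (o z : T) : ℕ × ℝ := (Nat.find (exists_mem_spanningSeg o z), dist o z)

theorem measurable_segCoord : Measurable (segCoord o) := by
  classical
  exact (measurable_find (exists_mem_spanningSeg o) (measurableSet_spanningSeg o)).prodMk
    (measurable_dist_left o)

theorem mem_spanningSeg_segCoord (z : T) : z ∈ spanningSeg o (segCoord o z).1 := by
  classical
  exact Nat.find_spec (exists_mem_spanningSeg o z)

/-- On a segment from `o` the distance to `o` determines the point, so a fibre is at most a point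
unless its index is `0`, where the whole piece is null. -/
theorem lengthMeasure_preimage_segCoord_singleton (c : ℕ × ℝ) :
    lengthMeasure T (segCoord o ⁻¹' {c}) = 0 := by
  obtain ⟨n, t⟩ := c
  have hsub : segCoord o ⁻¹' {(n, t)} ⊆ spanningSeg o n := fun z hz => by
    have := mem_spanningSeg_segCoord o z
    rwa [show segCoord o z = (n, t) from hz] at this
  cases n with
  | zero => exact measure_mono_null hsub (lengthMeasure_spanningSeg_zero o)
  | succ n =>
    refine Set.Subsingleton.measure_zero (fun z hz w hw => ?_) _
    have h1 : dist o z = t := congrArg Prod.snd (show segCoord o z = _ from hz)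
    have h2 : dist o w = t := congrArg Prod.snd (show segCoord o w = _ from hw)
    refine dist_eq_zero.1 ?_
    rw [dist_of_mem_seg (hsub hz) (hsub hw), h1, h2, sub_self, abs_zero]

/-- The first index cuts `T` into countably many pieces, each null or inside a segment from `o`,
where `dist o` determines measurable sets up to null sets. -/
theorem exists_ae_eq_preimage_segCoord {A : Set T} (hA : MeasurableSet A) :
    ∃ C : Set (ℕ × ℝ), MeasurableSet C ∧ A =ᵐ[lengthMeasure T] segCoord o ⁻¹' C := by
  have h : ∀ n, ∃ C : Set ℝ, MeasurableSet C ∧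
      (A ∩ spanningSeg o n : Set T) =ᵐ[lengthMeasure T] (dist o ⁻¹' C ∩ spanningSeg o n : Set T) := by
    intro n
    cases n with
    | zero =>
      refine ⟨∅, MeasurableSet.empty, ?_⟩
      have := measure_mono_null (inter_subset_right (s := A)) (lengthMeasure_spanningSeg_zero o)
      rw [preimage_empty, empty_inter]
      exact ae_eq_empty.2 this
    | succ n => exact exists_ae_eq_preimage_dist hA o _
  choose C hC he using h
  refine ⟨⋃ n, {n} ×ˢ C n, MeasurableSet.iUnion fun n => (measurableSet_singleton n).prod (hC n), ?_⟩
  have hD : ∀ n, (A ∩ {z | (segCoord o z).1 = n} : Set T) =ᵐ[lengthMeasure T]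
      segCoord o ⁻¹' ({n} ×ˢ C n) := by
    intro n
    have hsub : {z | (segCoord o z).1 = n} ⊆ spanningSeg o n := fun z hz => by
      have := mem_spanningSeg_segCoord o z
      rwa [show (segCoord o z).1 = n from hz] at this
    have e1 : A ∩ {z | (segCoord o z).1 = n} =
        (A ∩ spanningSeg o n) ∩ {z | (segCoord o z).1 = n} := by
      rw [inter_assoc, inter_eq_right.2 hsub]
    have e2 : segCoord o ⁻¹' ({n} ×ˢ C n) =
        (dist o ⁻¹' C n ∩ spanningSeg o n) ∩ {z | (segCoord o z).1 = n} := by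
      rw [inter_assoc, inter_eq_right.2 hsub, inter_comm]
      rfl
    rw [e1, e2]
    exact (he n).inter Filter.EventuallyEq.rfl
  have hU : A = ⋃ n, A ∩ {z | (segCoord o z).1 = n} := by
    ext z
    simp
  rw [preimage_iUnion]
  exact Filter.EventuallyEq.trans (Filter.EventuallyEq.of_eq hU)
    (Filter.EventuallyEq.countable_iUnion hD)

theorem nonempty_Lp_lengthMeasure_equiv [Nontrivial T] :
    Nonempty (Lp ℝ 1 (lengthMeasure T) ≃ₗᵢ[ℝ]
      Lp ℝ 1 ((volume : Measure ℝ).restrict (Icc 0 1))) := by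
  obtain ⟨o⟩ : Nonempty T := inferInstance
  have := sigmaFinite_lengthMeasure (T := T)
  -- A measurable embedding of `ℕ × ℝ` into `ℝ` turns the coordinate into one real function.
  have hemb := measurableEmbedding_embeddingReal (ℕ × ℝ)
  refine nonempty_Lp_one_equiv_unitInterval (lengthMeasure T) (lengthMeasure_ne_zero T)
    (hemb.measurable.comp (measurable_segCoord o)) (fun t => ?_) fun A hA => ?_
  · rw [preimage_comp]
    by_cases ht : t ∈ range (embeddingReal (ℕ × ℝ))
    · obtain ⟨c, rfl⟩ := ht
      rw [← image_singleton, hemb.injective.preimage_image]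
      exact lengthMeasure_preimage_segCoord_singleton o c
    · rw [preimage_singleton_eq_empty.2 ht, preimage_empty, measure_empty]
  · obtain ⟨C, hC, he⟩ := exists_ae_eq_preimage_segCoord o hA
    refine ⟨embeddingReal (ℕ × ℝ) '' C, hemb.measurableSet_image.2 hC, ?_⟩
    rwa [preimage_comp, hemb.injective.preimage_image]

end RTree

/-- The Lipschitz-free space of an ℝ-tree is linearly isometric to `L₁` of the length measure, for
any choice of the origin; for a separable ℝ-tree with more than one point it is linearly isometric
to `L₁([0,1])`. -/
theorem corollary3p3 (T : Type*) [MetricSpace T] [IsRTree T] :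
    (∀ o : T, Nonempty (↥(LipFree o) ≃ₗᵢ[ℝ] ↥(Lp ℝ 1 (RTree.lengthMeasure T)))) ∧
      (TopologicalSpace.SeparableSpace T → Nontrivial T →
        ∀ o : T, Nonempty (↥(LipFree o) ≃ₗᵢ[ℝ]
          ↥(Lp ℝ 1 ((volume : Measure ℝ).restrict (Icc 0 1))))) := by
  refine ⟨fun o => ⟨RTree.lipFreeEquiv o⟩, fun _ _ o => ?_⟩
  obtain ⟨e⟩ := RTree.nonempty_Lp_lengthMeasure_equiv (T := T)
  exact ⟨(RTree.lipFreeEquiv o).trans e⟩
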